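/- Throughout, graphs are finite and simple. For a graph $G$ let $d_G(x)$ be the degree of a vertex $x$, $\mathrm{dist}_G$ the distance in $G$, and $\omega(G)$ the number of connected components of $G$. For $S\subseteq V(G)$, $G-S$ is the subgraph induced by $V(G)\setminus S$, and $S$ is a vertex cut if $G-S$ is disconnected. $G$ is $1$-tough if $|S|\ge \omega(G-S)$ for every vertex cut $S$ of $G$. $G$ is $k$-connected if $|V(G)|>k$ and $G-S$ is connected for every $S\subseteq V(G)$ with $|S|<k$. $G$ is $(P_2\cup kP_1)$-free if no induced subgraph of $G$ is isomorphic to the graph $P_2\cup kP_1$ consisting of one edge and $k$ isolated vertices. $G$ is hamiltonian if it has a cycle containing every vertex of $G$. A $j$-essential independent set of $G$ is an independent set $S\subseteq V(G)$ with $|S|=j$ for which there is $x\in S$ such that $\mathrm{dist}_G(x,v)=2$ for all $v\in S\setminus\{x\}$. Define $$\mu_j(G)=\min\Bigl\{\max_{x\in S} d_G(x) : S \text{ is a } j\text{-essential independent set of } G\Bigr\},$$ with $\mu_j(G)=+\infty$ if $G$ has no $j$-essential independent set. **Theorem.** Let $k\ge 2$ be an integer and let $G$ be a $1$-tough, $k$-connected,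 $(P_2\cup kP_1)$-free graph. If $$\mu_{k+1}(G)\ge \frac{7k-6}{5},$$ then $G$ is hamiltonian or $G$ is isomorphic to the Petersen graph. -/

import Mathlib

namespace SimpleGraph

/-- The number of connected components of a graph. -/
noncomputable def numComponents {V : Type*} (G : SimpleGraph V) : ℕ :=
  Nat.card G.ConnectedComponent

/-- `S` is a vertex cut of `G` if `G - S` is disconnected. -/
def IsVertexCut {V : Type*} (G : SimpleGraph V) (S : Finset V) : Prop :=
  ¬ (G.induce ((S : Set V)ᶜ)).Preconnected

/-- `G` is `t`-tough if `|S| ≥ t · ω(G - S)` for each vertex cut `S`, where `ω` is the number of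
components. -/
def IsTough {V : Type*} (G : SimpleGraph V) (t : ℝ) : Prop :=
  ∀ S : Finset V, G.IsVertexCut S →
    t * ((G.induce ((S : Set V)ᶜ)).numComponents : ℝ) ≤ (S.card : ℝ)

/-- `G` is `k`-connected if it has more than `k` vertices and remains connected after the deletion
of any set of fewer than `k` vertices. -/
def IsVertexConnected {V : Type*} [Fintype V] (G : SimpleGraph V) (k : ℕ) : Prop :=
  k < Fintype.card V ∧ ∀ S : Finset V, S.card < k → (G.induce ((S : Set V)ᶜ)).Connected

/-- The graph `P₂ ∪ kP₁`: one edge and `k` isolated vertices. -/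
def edgeUnionIsolated (k : ℕ) : SimpleGraph (Fin 2 ⊕ Fin k) :=
  pathGraph 2 ⊕g (⊥ : SimpleGraph (Fin k))

/-- `G` is `H`-free if it has no induced subgraph isomorphic to `H`. -/
def IsInducedFree {V W : Type*} (G : SimpleGraph V) (H : SimpleGraph W) : Prop :=
  ¬ H.IsIndContained G

/-- `S` is a `k`-essential independent set of `G` with center `x`. As the distance required is
nonzero, it is a genuine distance (Mathlib's `dist` is `0` between unreachable vertices). -/
def IsEssentialIndepSetWithCenter {V : Type*} (G : SimpleGraph V) (k : ℕ) (S : Finset V)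
    (x : V) : Prop :=
  G.IsIndepSet (S : Set V) ∧ S.card = k ∧ x ∈ S ∧ ∀ v ∈ S, v ≠ x → G.dist x v = 2

/-- `S` is a `k`-essential independent set of `G`. -/
def IsEssentialIndepSet {V : Type*} (G : SimpleGraph V) (k : ℕ) (S : Finset V) : Prop :=
  ∃ x, G.IsEssentialIndepSetWithCenter k S x

/-- `μ_k(G)`: the minimum of `max_{x ∈ S} d_G(x)` over all `k`-essential independent sets `S`
of `G`, and `∞` if there is no such set. -/
noncomputable def essentialMu {V : Type*} [Fintype V] (G : SimpleGraph V) [DecidableRel G.Adj]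
    (k : ℕ) : ℕ∞ :=
  ⨅ S : {S : Finset V // G.IsEssentialIndepSet k S}, ((S.1.sup fun x => G.degree x : ℕ) : ℕ∞)

/-- The Petersen graph: the vertices are the 2-element subsets of a 5-element set, adjacent when
they are disjoint. -/
def petersenGraph : SimpleGraph {s : Finset (Fin 5) // s.card = 2} where
  Adj s t := Disjoint s.1 t.1
  symm := ⟨fun _ _ h => h.symm⟩
  loopless := ⟨fun s h => by
    have h1 : s.1 = ∅ := by simpa using h
    have h2 := s.2
    simp [h1] at h2⟩

end SimpleGraph

/-! Suppose the graph is not hamiltonian. Let c_0, …, c_{n-1} be a longest cycle missing a vertex x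
of degree d. An edge off the cycle would lie in a component with at least k attachments to the
cycle, and the successors of these, with the edge, would give an induced P₂ ∪ kP₁. So the vertices
off the cycle are independent (`Frame.outer_not_adj`) and N(x) lies on the cycle. Let X index N(x),
and let S consist of x and the successors of N(x). S is independent with d + 1 > k elements, so a
vertex with one neighbour in S has fewer than k non-neighbours there, hence at least d + 2 - k
neighbours (`Config.le_card_filter`). Any successor can be exchanged with x
(`Config.exists_frame_succ`), so the hypothesis on μ_{k+1}, applied to x and k successors, lets x be
chosen with 5d ≥ 7k - 6 (`exists_config`).

Toughness yields two consecutive cycle vertices with neighbours in S (`Config.exists_consecutive`),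
and a count lets the numbering be chosen so that c_0 is in N(x) and c_{n-1} has a neighbour in S
(`Config.exists_rotate`). Since the cycle is longest, no Hamiltonian path on its vertices joins two
members of N(x). Call i in X an attachment of u if u is adjacent to c_{i+1}. Pósa rotations of the
path c_0 … c_{n-1}, with c_0 fixed, produce further ends c_{a+2} and c_{j+2}, and the attachments of
these ends are confined to segments that the rotated path traverses forwards. The attachment sets of
c_0, c_{j+2}, c_{a+2} and c_{a+3} thus overlap so little that they fit into X only if 3d + 3 ≤ 4k
(`Based.exists_structure`). With 5d ≥ 7k - 6 and d ≥ k this leaves k = d = 3, with equality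
throughout.

Equality determines the gaps of X, whence n = 9 (`Based.structure_eq_three`), and supplies fifteen
edges on ten vertices that form the Petersen graph. Any further edge or vertex would give a longer
cycle or a forbidden induced subgraph (`Based.nonempty_iso`). -/

namespace SimpleGraph

variable {V : Type*} {G : SimpleGraph V}

/-! ### Longest cycles and the ways to lengthen them -/

/-- A walk whose support has at most `T.card` entries and covers `T` is a path with support `T`. -/
lemma Walk.isPath_of_card_le {u v : V} (p : G.Walk u v) (T : Finset V)
    (hT : ∀ t ∈ T, t ∈ p.support) (h : p.support.length ≤ T.card) :
    p.IsPath ∧ ∀ w ∈ p.support, w ∈ T := by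
  classical
  have hsub : T ⊆ p.support.toFinset := fun t ht => List.mem_toFinset.2 (hT t ht)
  have h1 : T.card ≤ p.support.toFinset.card := Finset.card_le_card hsub
  have h2 : p.support.toFinset.card ≤ p.support.length := List.toFinset_card_le _
  have heq : T = p.support.toFinset := Finset.eq_of_subset_of_card_le hsub (by omega)
  refine ⟨Walk.IsPath.mk' ?_, fun w hw => ?_⟩
  · exact Multiset.coe_nodup.1 (Multiset.toFinset_card_eq_card_iff_nodup.1
      (show p.support.toFinset.card = p.support.length by omega))
  · rw [heq]; exact List.mem_toFinset.2 hw

/-- Closing a path of length at least two by an edge gives a cycle. -/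
lemma Walk.IsPath.cons_isCycle_of_two_le {u v : V} {p : G.Walk u v} (hp : p.IsPath)
    (h : G.Adj v u) (hl : 2 ≤ p.length) : (Walk.cons h p).IsCycle := by
  rw [Walk.cons_isCycle_iff]
  refine ⟨hp, fun hmem => ?_⟩
  cases p with
  | nil => simp at hl
  | cons h' q =>
    rw [Walk.cons_isPath_iff] at hp
    rw [Walk.edges_cons, List.mem_cons] at hmem
    rcases hmem with hmem | hmem
    · rw [Sym2.eq_swap, Sym2.congr_right] at hmem
      subst hmem
      have := Walk.length_eq_zero_iff.2 (Walk.isPath_iff_nil.1 hp.1)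
      rw [Walk.length_cons] at hl
      omega
    · exact hp.2 (Walk.snd_mem_support_of_mem_edges _ hmem)

/-- `c` enumerates periodically a longest cycle of `G`, of length `n`, that misses `x`. -/
structure Frame (G : SimpleGraph V) (n : ℕ) (c : ℕ → V) (x : V) : Prop where
  three_le : 3 ≤ n
  periodic : ∀ i, c (i + n) = c i
  inj : ∀ i < n, ∀ j < n, c i = c j → i = j
  adj : ∀ i, G.Adj (c i) (c (i + 1))
  ne : ∀ i, c i ≠ x
  max : ∀ u (q : G.Walk u u), q.IsCycle → q.length ≤ n

/-- A walk from `c a` to `c b` with `m` vertices, counted with multiplicity, that covers `c '' s`. -/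
def Run (G : SimpleGraph V) (c : ℕ → V) (a b m : ℕ) (s : Set ℕ) : Prop :=
  ∃ p : G.Walk (c a) (c b), p.support.length = m ∧ ∀ i ∈ s, c i ∈ p.support

lemma Run.symm {c : ℕ → V} {a b m : ℕ} {s : Set ℕ} (h : Run G c a b m s) : Run G c b a m s := by
  obtain ⟨p, hp, hs⟩ := h
  exact ⟨p.reverse, by simpa using hp, fun i hi => by simpa using hs i hi⟩

lemma Run.append {c : ℕ → V} {a b a' b' m m' : ℕ} {s s' : Set ℕ} (h : Run G c a b m s)
    (hadj : G.Adj (c b) (c a')) (h' : Run G c a' b' m' s') :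
    Run G c a b' (m + m') (s ∪ s') := by
  obtain ⟨p, hp, hs⟩ := h
  obtain ⟨q, hq, hs'⟩ := h'
  refine ⟨p.append (Walk.cons hadj q), ?_, ?_⟩
  · simp only [Walk.length_support, Walk.length_append, Walk.length_cons] at *
    omega
  · intro i hi
    rw [Walk.mem_support_append_iff, Walk.support_cons]
    rcases hi with hi | hi
    · exact Or.inl (hs i hi)
    · exact Or.inr (List.mem_cons_of_mem _ (hs' i hi))

namespace Frame

variable {n : ℕ} {c : ℕ → V} {x : V}

lemma periodic_mul (F : Frame G n c x) (i m : ℕ) : c (i + n * m) = c i := by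
  induction m with
  | zero => simp
  | succ m ih => rw [Nat.mul_succ, ← add_assoc, F.periodic, ih]

lemma mod_eq (F : Frame G n c x) (i : ℕ) : c (i % n) = c i := by
  conv_rhs => rw [← Nat.mod_add_div i n]
  exact (F.periodic_mul _ _).symm

lemma zero_eq (F : Frame G n c x) : c n = c 0 := by
  simpa using F.periodic 0

lemma wrap (F : Frame G n c x) : G.Adj (c (n - 1)) (c 0) := by
  have h := F.adj (n - 1)
  have := F.three_le
  rwa [Nat.sub_add_cancel (by omega), F.zero_eq] at h

lemma up (F : Frame G n c x) {i j : ℕ} (hij : i ≤ j) :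
    Run G c i j (j + 1 - i) (Set.Icc i j) := by
  induction j, hij using Nat.le_induction with
  | base =>
    refine ⟨Walk.nil, by simp, ?_⟩
    rintro k ⟨h1, h2⟩
    have : k = i := by omega
    simp [this]
  | succ j hij ih =>
    obtain ⟨p, hp, hs⟩ := ih
    refine ⟨p.append (Walk.cons (F.adj j) Walk.nil), ?_, ?_⟩
    · simp only [Walk.length_support, Walk.length_append, Walk.length_cons, Walk.length_nil] at *
      omega
    · rintro k ⟨h1, h2⟩
      rw [Walk.mem_support_append_iff, Walk.support_cons]
      rcases Nat.lt_or_ge j k with h | h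
      · have : k = j + 1 := by omega
        subst this
        simp
      · exact Or.inl (hs k ⟨h1, h⟩)

lemma down (F : Frame G n c x) {i j : ℕ} (hij : i ≤ j) :
    Run G c j i (j + 1 - i) (Set.Icc i j) :=
  (F.up hij).symm

lemma one (_F : Frame G n c x) (i : ℕ) : Run G c i i 1 {i} :=
  ⟨Walk.nil, by simp, by simp⟩

/-- The vertices of the cycle. -/
lemma card_image [DecidableEq V] (F : Frame G n c x) :
    ((Finset.range n).image c).card = n := by
  rw [Finset.card_image_of_injOn, Finset.card_range]
  intro i hi j hj h
  exact F.inj i (by simpa using hi) j (by simpa using hj) h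

/-- Counting replaces any check of simplicity: a walk with no more entries than the set it covers
repeats none. Paths glued from arcs of the cycle therefore need only a length and a coverage check,
both left to arithmetic. -/
lemma no_closed (F : Frame G n c x) {u v : V} (p : G.Walk u v) (T : Finset V)
    (hT : ∀ t ∈ T, t ∈ p.support) (h : p.support.length ≤ T.card) (hn : n < T.card)
    (hadj : G.Adj v u) : False := by
  classical
  obtain ⟨hp, hsub⟩ := p.isPath_of_card_le T hT h
  have h1 : T.card ≤ p.support.length := by
    calc T.card ≤ p.support.toFinset.card :=
          Finset.card_le_card fun t ht => List.mem_toFinset.2 (hT t ht)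
      _ ≤ _ := List.toFinset_card_le _
  have h3 := F.three_le
  rw [Walk.length_support] at h1
  have := F.max _ _ (hp.cons_isCycle_of_two_le hadj (by omega))
  simp only [Walk.length_cons] at this
  omega

/-- No Hamiltonian path of the cycle can be closed by a path outside the cycle. -/
lemma no_detour (F : Frame G n c x) {a b m : ℕ} {s : Set ℕ} (h : Run G c a b m s)
    (hm : m = n) (hs : ∀ i < n, i ∈ s) {u v : V} (r : G.Walk u v) (hr : r.IsPath)
    (hout : ∀ w ∈ r.support, ∀ i, c i ≠ w) (hu : G.Adj (c b) u) (hv : G.Adj v (c a)) : False := by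
  classical
  obtain ⟨p, hp, hps⟩ := h
  have hdisj : Disjoint ((Finset.range n).image c) r.support.toFinset := by
    rw [Finset.disjoint_left]
    rintro w hw hw'
    obtain ⟨i, -, rfl⟩ := Finset.mem_image.1 hw
    exact hout _ (List.mem_toFinset.1 hw') i rfl
  have hcard : ((Finset.range n).image c ∪ r.support.toFinset).card = n + r.support.length := by
    rw [Finset.card_union_of_disjoint hdisj, F.card_image, List.toFinset_card_of_nodup hr.support_nodup]
  have hpos : 0 < r.support.length := by simp
  refine F.no_closed (p.append (Walk.cons hu r)) ((Finset.range n).image c ∪ r.support.toFinset)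
    ?_ ?_ ?_ hv
  · intro t ht
    rw [Walk.mem_support_append_iff, Walk.support_cons]
    rcases Finset.mem_union.1 ht with ht | ht
    · obtain ⟨i, hi, rfl⟩ := Finset.mem_image.1 ht
      exact Or.inl (hps i (hs i (Finset.mem_range.1 hi)))
    · exact Or.inr (List.mem_cons_of_mem _ (List.mem_toFinset.1 ht))
  · rw [hcard]
    simp only [Walk.length_support, Walk.length_append, Walk.length_cons] at *
    omega
  · omega

/-- No Hamiltonian path of the cycle joins two neighbours of `x`. -/
lemma not_run (F : Frame G n c x) {a b m : ℕ} {s : Set ℕ} (ha : G.Adj x (c a))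
    (hb : G.Adj x (c b)) (h : Run G c a b m s) (hm : m = n) (hs : ∀ i < n, i ∈ s) : False :=
  F.no_detour h hm hs (Walk.nil : G.Walk x x) (by simp) (by simpa using F.ne) hb.symm ha

/-- Two vertices outside the cycle cannot both be inserted into it. -/
lemma not_run_two (F : Frame G n c x) {a b a' b' m m' : ℕ} {s s' : Set ℕ} {y : V} (hxy : x ≠ y)
    (hy : ∀ i, c i ≠ y) (h : Run G c a b m s) (hb : G.Adj x (c b)) (ha' : G.Adj x (c a'))
    (h' : Run G c a' b' m' s') (hb' : G.Adj y (c b')) (ha : G.Adj y (c a))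
    (hm : m + m' = n) (hs : ∀ i < n, i ∈ s ∨ i ∈ s') : False := by
  classical
  obtain ⟨p, hp, hps⟩ := h
  obtain ⟨q, hq, hqs⟩ := h'
  have hx : x ∉ (Finset.range n).image c := by
    intro h
    obtain ⟨i, -, hi⟩ := Finset.mem_image.1 h
    exact F.ne i hi
  have hy' : y ∉ insert x ((Finset.range n).image c) := by
    intro h
    rcases Finset.mem_insert.1 h with h | h
    · exact hxy h.symm
    obtain ⟨i, -, hi⟩ := Finset.mem_image.1 h
    exact hy i hi
  have hcard : (insert y (insert x ((Finset.range n).image c))).card = n + 2 := by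
    rw [Finset.card_insert_of_notMem hy', Finset.card_insert_of_notMem hx, F.card_image]
  refine F.no_closed (Walk.cons ha (p.append (Walk.cons hb.symm (Walk.cons ha' q))))
    (insert y (insert x ((Finset.range n).image c))) ?_ ?_ ?_ hb'.symm
  · intro t ht
    simp only [Walk.support_cons, Walk.mem_support_append_iff, List.mem_cons]
    rcases Finset.mem_insert.1 ht with rfl | ht
    · simp
    rcases Finset.mem_insert.1 ht with rfl | ht
    · simp
    · obtain ⟨i, hi, rfl⟩ := Finset.mem_image.1 ht
      rcases hs i (Finset.mem_range.1 hi) with hi | hi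
      · exact Or.inr (Or.inl (hps i hi))
      · exact Or.inr (Or.inr (Or.inr (Or.inr (hqs i hi))))
  · rw [hcard]
    simp only [Walk.length_support, Walk.length_append, Walk.length_cons] at *
    omega
  · omega

/-- Shifting the starting point of the cycle. -/
lemma rotate (F : Frame G n c x) (r : ℕ) : Frame G n (fun i => c (i + r)) x where
  three_le := F.three_le
  periodic i := by rw [add_right_comm]; exact F.periodic _
  inj i hi j hj h := by
    have h1 : (i + r) % n = (j + r) % n := by
      have h3 := F.three_le
      apply F.inj _ (Nat.mod_lt _ (by omega)) _ (Nat.mod_lt _ (by omega))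
      rw [F.mod_eq, F.mod_eq]; exact h
    have h2 : i ≡ j [MOD n] := Nat.ModEq.add_right_cancel' r h1
    rwa [Nat.ModEq, Nat.mod_eq_of_lt hi, Nat.mod_eq_of_lt hj] at h2
  adj i := by rw [add_right_comm]; exact F.adj _
  ne i := F.ne _
  max := F.max

/-- A frame from a longest cycle and a vertex that it misses. -/
lemma _root_.SimpleGraph.Walk.IsCycle.frame {u : V} {q : G.Walk u u} (hq : q.IsCycle)
    (hmax : ∀ u (q' : G.Walk u u), q'.IsCycle → q'.length ≤ q.length) (hx : x ∉ q.support) :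
    Frame G q.length (fun i => q.getVert (i % q.length)) x where
  three_le := hq.three_le_length
  periodic i := by simp
  inj i hi j hj h := by
    have h : q.getVert (i % q.length) = q.getVert (j % q.length) := h
    rw [Nat.mod_eq_of_lt hi, Nat.mod_eq_of_lt hj] at h
    exact hq.getVert_injOn' (by simp; omega) (by simp; omega) h
  adj i := by
    have h3 := hq.three_le_length
    have hlt : i % q.length < q.length := Nat.mod_lt _ (by omega)
    have h := q.adj_getVert_succ hlt
    show G.Adj (q.getVert (i % q.length)) (q.getVert ((i + 1) % q.length))
    rw [Nat.add_mod, Nat.mod_eq_of_lt (show 1 < q.length by omega)]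
    rcases Nat.lt_or_ge (i % q.length + 1) q.length with h1 | h1
    · rwa [Nat.mod_eq_of_lt h1]
    · have h2 : i % q.length + 1 = q.length := by omega
      rw [h2, Walk.getVert_length] at h
      rw [h2, Nat.mod_self, Walk.getVert_zero]
      exact h
  ne i h := hx (h ▸ Walk.getVert_mem_support _ _)
  max := hmax

end Frame

/-! ### Freeness, connectivity and the existence of a longest cycle -/

lemma IsInducedFree.card_lt {k : ℕ} (hfree : G.IsInducedFree (edgeUnionIsolated k)) {u v : V}
    (huv : G.Adj u v) (J : Finset V) (hJ : G.IsIndepSet (J : Set V))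
    (hu : ∀ j ∈ J, ¬ G.Adj u j) (hv : ∀ j ∈ J, ¬ G.Adj v j) (hu' : u ∉ J) (hv' : v ∉ J) :
    J.card < k := by
  by_contra! hcard
  obtain ⟨e⟩ : Nonempty (Fin k ↪ J) :=
    Function.Embedding.nonempty_of_card_le (by simpa using hcard)
  have hind : ∀ i j, ¬ G.Adj (e i : V) (e j) := fun i j h =>
    hJ (e i).2 (e j).2 h.ne h
  have h1 : ∀ i, (e i : V) ≠ u := fun i h => hu' (h ▸ (e i).2)
  have h2 : ∀ i, (e i : V) ≠ v := fun i h => hv' (h ▸ (e i).2)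
  have h3 : ∀ i, ¬ G.Adj u (e i : V) := fun i => hu _ (e i).2
  have h4 : ∀ i, ¬ G.Adj v (e i : V) := fun i => hv _ (e i).2
  refine hfree ⟨⟨⟨Sum.elim ![u, v] (fun i => (e i : V)), ?_⟩, ?_⟩⟩
  · rintro (a | a) (b | b) hab
    · fin_cases a <;> fin_cases b <;> simp_all [huv.ne, huv.ne']
    · fin_cases a
      · exact absurd hab.symm (h1 b)
      · exact absurd hab.symm (h2 b)
    · fin_cases b
      · exact absurd hab (h1 a)
      · exact absurd hab (h2 a)
    · exact congrArg _ (e.injective (Subtype.ext hab))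
  · have hp : ∀ a b, G.Adj (![u, v] a) (![u, v] b) ↔ (pathGraph 2).Adj a b := by
      intro a b
      fin_cases a <;> fin_cases b <;> simp [pathGraph_adj, huv, huv.symm]
    have hq : ∀ a i, ¬ G.Adj (![u, v] a) (e i) := by
      intro a i
      fin_cases a
      · exact h3 i
      · exact h4 i
    rintro (a | a) (b | b)
    · change G.Adj (![u, v] a) (![u, v] b) ↔ (edgeUnionIsolated k).Adj (Sum.inl a) (Sum.inl b)
      simpa [edgeUnionIsolated] using hp a b
    · change G.Adj (![u, v] a) (e b : V) ↔ (edgeUnionIsolated k).Adj (Sum.inl a) (Sum.inr b)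
      simpa [edgeUnionIsolated] using hq a b
    · change G.Adj (e a : V) (![u, v] b) ↔ (edgeUnionIsolated k).Adj (Sum.inr a) (Sum.inl b)
      simpa [edgeUnionIsolated, G.adj_comm] using hq b a
    · change G.Adj (e a : V) (e b : V) ↔ (edgeUnionIsolated k).Adj (Sum.inr a) (Sum.inr b)
      simpa [edgeUnionIsolated] using hind a b

/-- In a `(P₂ ∪ kP₁)`-free graph a vertex with a neighbour in an independent set `J` has fewer than
`k` non-neighbours in `J`. -/
lemma IsInducedFree.card_filter_not_adj_lt {k : ℕ}
    (hfree : G.IsInducedFree (edgeUnionIsolated k)) [DecidableRel G.Adj] {J : Finset V}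
    (hJ : G.IsIndepSet (J : Set V)) {w s : V} (hs : s ∈ J) (hws : G.Adj w s) :
    (J.filter fun j => ¬ G.Adj w j).card < k := by
  refine hfree.card_lt hws.symm _ (fun a ha b hb => hJ ?_ ?_) ?_ ?_ ?_ ?_
  · exact (Finset.mem_filter.1 (Finset.mem_coe.1 ha)).1
  · exact (Finset.mem_filter.1 (Finset.mem_coe.1 hb)).1
  · intro j hj h
    exact hJ hs (Finset.mem_filter.1 hj).1 h.ne h
  · intro j hj
    exact (Finset.mem_filter.1 hj).2
  · intro h
    exact (Finset.mem_filter.1 h).2 hws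
  · intro h
    exact hJ hs (Finset.mem_filter.1 h).1 hws.ne' hws.symm

/-- In a `k`-connected graph a set with fewer than `k` outer neighbours has no other vertices
outside. -/
lemma IsVertexConnected.mem_or_mem [Fintype V] {k : ℕ} (h : G.IsVertexConnected k) {S : Finset V}
    (hS : S.card < k) {D : Set V} (hD : ∀ a ∈ D, ∀ b, G.Adj a b → b ∈ D ∨ b ∈ S)
    {a : V} (ha : a ∈ D) (haS : a ∉ S) (v : V) : v ∈ D ∨ v ∈ S := by
  by_contra! hv
  have hconn := h.2 S hS
  obtain ⟨p⟩ := hconn.preconnected ⟨a, by simpa using haS⟩ ⟨v, by simpa using hv.2⟩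
  have key : ∀ (y z : ((S : Set V)ᶜ : Set V)), (G.induce ((S : Set V)ᶜ)).Walk y z →
      (y : V) ∈ D → (z : V) ∈ D := by
    intro y z q
    induction q with
    | nil => exact id
    | @cons a b _ hab _ ih =>
      intro hy
      refine ih ((hD _ hy _ hab).resolve_right ?_)
      exact fun hb => b.2 hb
  exact hv.1 (key _ _ p ha)

lemma IsVertexConnected.le_degree [Fintype V] [DecidableRel G.Adj] {k : ℕ}
    (h : G.IsVertexConnected k) (v : V) : k ≤ G.degree v := by
  classical
  by_contra! hlt
  have hall := h.mem_or_mem (S := G.neighborFinset v) (D := {v}) (by simpa using hlt)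
    (by
      rintro a rfl b hab
      exact Or.inr (by simpa using hab)) rfl (by simp)
  have : (Finset.univ : Finset V) ⊆ insert v (G.neighborFinset v) := by
    intro w _
    rcases hall w with hw | hw
    · rw [Set.mem_singleton_iff] at hw
      simp [hw]
    · exact Finset.mem_insert_of_mem hw
  have := Finset.card_le_card this
  have h2 := Finset.card_insert_le v (G.neighborFinset v)
  rw [card_neighborFinset_eq_degree] at h2
  rw [Finset.card_univ] at this
  have := h.1
  omega

lemma Walk.IsCycle.length_le_card [Fintype V] {u : V} {q : G.Walk u u} (hq : q.IsCycle) :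
    q.length ≤ Fintype.card V := by
  have := hq.support_nodup.length_le_card
  simpa using this

lemma IsVertexConnected.connected [Fintype V] {k : ℕ} (hk : 0 < k) (h : G.IsVertexConnected k) :
    G.Connected := by
  have : Nonempty V := Fintype.card_pos_iff.1 (by have := h.1; omega)
  refine ⟨fun u v => ?_⟩
  rcases h.mem_or_mem (S := ∅) (D := {w | G.Reachable u w}) (by simpa using hk)
    (fun a ha b hab => Or.inl (Reachable.trans ha hab.reachable)) (Reachable.refl u) (by simp) v
    with hv | hv
  · exact hv
  · simp at hv

/-- A non-hamiltonian `k`-connected graph has a longest cycle, and it misses a vertex. -/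
lemma IsVertexConnected.exists_frame [Fintype V] [DecidableEq V] {k : ℕ} (hk : 2 ≤ k)
    (h : G.IsVertexConnected k) (hham : ¬ G.IsHamiltonian) :
    ∃ n c x, Frame G n c x := by
  classical
  have hcyc : ∃ u, ∃ q : G.Walk u u, q.IsCycle := by
    by_contra! hno
    have : Nontrivial V := Fintype.one_lt_card_iff_nontrivial.1 (by have := h.1; omega)
    have htree : G.IsTree := ⟨h.connected (by omega), fun u q hq => hno u q hq⟩
    obtain ⟨v, hv⟩ := htree.exists_vert_degree_one_of_nontrivial
    have := h.le_degree v
    omega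
  let P : ℕ → Prop := fun m => ∃ u, ∃ q : G.Walk u u, q.IsCycle ∧ q.length = m
  obtain ⟨u, q, hq⟩ := hcyc
  have hP : P (Nat.findGreatest P (Fintype.card V)) :=
    Nat.findGreatest_spec hq.length_le_card ⟨u, q, hq, rfl⟩
  obtain ⟨u', q', hq', hlen⟩ := hP
  have hmax : ∀ w (r : G.Walk w w), r.IsCycle → r.length ≤ q'.length := by
    intro w r hr
    rw [hlen]
    exact Nat.le_findGreatest hr.length_le_card ⟨w, r, hr, rfl⟩
  have hx : ∃ x, x ∉ q'.support := by
    by_contra! hall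
    refine hham fun _ => ⟨u', q', ?_⟩
    rw [Walk.isHamiltonianCycle_iff_isCycle_and_length_eq]
    refine ⟨hq', le_antisymm hq'.length_le_card ?_⟩
    have : (Finset.univ : Finset V) ⊆ q'.support.tail.toFinset := by
      intro v _
      rw [List.mem_toFinset]
      by_cases hv : v = u'
      · subst hv
        exact Walk.end_mem_tail_support hq'.not_nil
      · have := hall v
        rw [Walk.mem_support_iff] at this
        exact this.resolve_left hv
    have h1 := Finset.card_le_card this
    have h2 := List.toFinset_card_le q'.support.tail
    rw [Finset.card_univ] at h1
    simp at h2
    omega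
  obtain ⟨x, hx⟩ := hx
  exact ⟨_, _, x, hq'.frame hmax hx⟩

lemma Walk.exists_of_induce {K : Set V} {a b : K} (p : (G.induce K).Walk a b) (hp : p.IsPath) :
    ∃ r : G.Walk (a : V) b, r.IsPath ∧ ∀ w ∈ r.support, w ∈ K := by
  have key : ∃ r : G.Walk ((Embedding.induce (G := G) K).toHom a)
      ((Embedding.induce (G := G) K).toHom b), r.IsPath ∧ ∀ w ∈ r.support, w ∈ K := by
    refine ⟨p.map (Embedding.induce (G := G) K).toHom, hp.map Subtype.val_injective, ?_⟩
    intro w hw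
    rw [Walk.support_map, List.mem_map] at hw
    obtain ⟨w', -, rfl⟩ := hw
    exact w'.2
  exact key

/-! ### Independence of the vertices off a longest cycle -/

namespace Frame

variable {n : ℕ} {c : ℕ → V} {x : V}

lemma exists_lt_eq (F : Frame G n c x) (i : ℕ) : ∃ j < n, c j = c i :=
  ⟨i % n, Nat.mod_lt _ (by have := F.three_le; omega), F.mod_eq i⟩

/-- Two consecutive vertices of a longest cycle cannot be joined outside the cycle. -/
lemma no_detour_succ (F : Frame G n c x) (i : ℕ) {u v : V} (r : G.Walk u v) (hr : r.IsPath)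
    (hout : ∀ w ∈ r.support, ∀ i, c i ≠ w) (hu : G.Adj (c i) u) (hv : G.Adj v (c (i + 1))) :
    False := by
  have F' := F.rotate i
  have h3 := F.three_le
  refine F'.no_detour (a := 1) (b := 0) ((F'.up (i := 1) (j := n - 1) (by omega)).append F'.wrap
    (F'.one 0)) (by omega) ?_ r hr (fun w hw j => hout w hw _) (by simpa using hu) ?_
  · intro j hj
    simp only [Set.mem_union, Set.mem_Icc, Set.mem_singleton_iff]
    omega
  · simpa [add_comm] using hv

/-- Successors of two attachments of a piece outside a longest cycle are not adjacent. -/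
lemma no_detour_cross (F : Frame G n c x) {i j : ℕ} (hij : i < j) (hj : j < n) {u v : V}
    (r : G.Walk u v) (hr : r.IsPath)
    (hout : ∀ w ∈ r.support, ∀ i, c i ≠ w) (hu : G.Adj (c j) u) (hv : G.Adj v (c i)) :
    ¬ G.Adj (c (i + 1)) (c (j + 1)) := by
  intro hadj
  rcases Nat.lt_or_ge (j + 1) n with h | h
  · refine F.no_detour (((F.down (i := 0) (j := i) (by omega)).append F.wrap.symm
      (F.down (i := j + 1) (j := n - 1) (by omega))).append hadj.symm
      (F.up (i := i + 1) (j := j) (by omega))) (by omega) ?_ r hr hout hu hv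
    intro l hl
    simp only [Set.mem_union, Set.mem_Icc]
    omega
  · have hjn : j + 1 = n := by omega
    rw [hjn, F.zero_eq] at hadj
    refine F.no_detour ((F.down (i := 0) (j := i) (by omega)).append hadj.symm
      (F.up (i := i + 1) (j := j) (by omega))) (by omega) ?_ r hr hout hu hv
    intro l hl
    simp only [Set.mem_union, Set.mem_Icc]
    omega

/-- The vertices outside a longest cycle are independent. -/
lemma outer_not_adj [Fintype V] (F : Frame G n c x) {k : ℕ} (hconn : G.IsVertexConnected k)
    (hfree : G.IsInducedFree (edgeUnionIsolated k)) {y z : V} (hy : ∀ i, c i ≠ y)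
    (hz : ∀ i, c i ≠ z) : ¬ G.Adj y z := by
  classical
  intro hyz
  have h3 := F.three_le
  let K : Set V := (Set.range c)ᶜ
  have hyK : y ∈ K := by simpa [K] using hy
  have hzK : z ∈ K := by simpa [K] using hz
  let D : Set V := {h | ∃ hh : h ∈ K, (G.induce K).Reachable ⟨y, hyK⟩ ⟨h, hh⟩}
  have hyD : y ∈ D := ⟨hyK, Reachable.refl _⟩
  have hstep : ∀ a ∈ D, ∀ b, G.Adj a b → (∀ i, c i ≠ b) → b ∈ D := by
    rintro a ⟨ha, har⟩ b hab hb
    have hbK : b ∈ K := by simpa [K] using hb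
    exact ⟨hbK, har.trans (Adj.reachable (by simpa using hab))⟩
  have hzD : z ∈ D := hstep y hyD z hyz hz
  have hpath : ∀ u ∈ D, ∀ v ∈ D, ∃ r : G.Walk u v, r.IsPath ∧ ∀ w ∈ r.support, ∀ i, c i ≠ w := by
    rintro u ⟨hu, hur⟩ v ⟨hv, hvr⟩
    obtain ⟨p, hp⟩ := (hur.symm.trans hvr).exists_isPath
    obtain ⟨r, hr, hrK⟩ := p.exists_of_induce hp
    exact ⟨r, hr, fun w hw i hi => hrK w hw ⟨i, hi⟩⟩
  let J : Finset ℕ := (Finset.range n).filter fun i => ∃ h ∈ D, G.Adj (c i) h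
  have hsucc : ∀ i ∈ J, ∀ h ∈ D, ¬ G.Adj (c (i + 1)) h := by
    intro i hi h hh hadj
    obtain ⟨-, h', hh', hadj'⟩ := Finset.mem_filter.1 hi
    obtain ⟨r, hr, hout⟩ := hpath h' hh' h hh
    exact F.no_detour_succ i r hr hout hadj' hadj.symm
  have hcross : ∀ i ∈ J, ∀ j ∈ J, i < j → ¬ G.Adj (c (i + 1)) (c (j + 1)) := by
    intro i hi j hj hij
    obtain ⟨-, h', hh', hadj'⟩ := Finset.mem_filter.1 hi
    obtain ⟨hjn, h, hh, hadj⟩ := Finset.mem_filter.1 hj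
    obtain ⟨r, hr, hout⟩ := hpath h hh h' hh'
    exact F.no_detour_cross hij (Finset.mem_range.1 hjn) r hr hout hadj hadj'.symm
  have hJk : k ≤ J.card := by
    by_contra! hlt
    have hDS : ∀ a ∈ D, ∀ b, G.Adj a b → b ∈ D ∨ b ∈ J.image c := by
      intro a ha b hab
      by_cases hb : ∀ i, c i ≠ b
      · exact Or.inl (hstep a ha b hab hb)
      · push Not at hb
        obtain ⟨i, rfl⟩ := hb
        obtain ⟨j, hj, hji⟩ := F.exists_lt_eq i
        rw [← hji] at hab ⊢
        exact Or.inr (Finset.mem_image_of_mem _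
          (Finset.mem_filter.2 ⟨Finset.mem_range.2 hj, a, ha, hab.symm⟩))
    have hnD : ∀ i, c i ∉ D := fun i ⟨hi, _⟩ => hi ⟨i, rfl⟩
    have hall := hconn.mem_or_mem (S := J.image c) (lt_of_le_of_lt Finset.card_image_le hlt) hDS hyD
      (by
        intro h
        obtain ⟨i, -, hi⟩ := Finset.mem_image.1 h
        exact hy i hi)
    have hmem : ∀ i, ∃ h ∈ D, G.Adj (c i) h := by
      intro i
      obtain ⟨j, hj, hji⟩ := Finset.mem_image.1 ((hall (c i)).resolve_left (hnD i))
      rw [← hji]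
      exact (Finset.mem_filter.1 hj).2
    -- With fewer than k attachments, connectivity would make every cycle vertex an attachment. Two
    -- consecutive ones then contradict maximality.
    obtain ⟨h, hh, hadj⟩ := hmem 1
    exact hsucc 0 (Finset.mem_filter.2 ⟨Finset.mem_range.2 (by omega), hmem 0⟩) h hh hadj
  have hinj : Set.InjOn (fun i => c (i + 1)) (J : Set ℕ) := by
    intro i hi j hj h
    have hi' := Finset.mem_range.1 (Finset.mem_filter.1 (Finset.mem_coe.1 hi)).1
    have hj' := Finset.mem_range.1 (Finset.mem_filter.1 (Finset.mem_coe.1 hj)).1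
    exact (F.rotate 1).inj i hi' j hj' h
  have hlt := hfree.card_lt hyz (J.image fun i => c (i + 1)) ?_ ?_ ?_ ?_ ?_
  · rw [Finset.card_image_of_injOn hinj] at hlt
    omega
  · intro a ha b hb hab hadj
    obtain ⟨i, hi, rfl⟩ := Finset.mem_image.1 (Finset.mem_coe.1 ha)
    obtain ⟨j, hj, rfl⟩ := Finset.mem_image.1 (Finset.mem_coe.1 hb)
    rcases Nat.lt_trichotomy i j with h | h | h
    · exact hcross i hi j hj h hadj
    · exact hab (by rw [h])
    · exact hcross j hj i hi h hadj.symm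
  · intro a ha
    obtain ⟨i, hi, rfl⟩ := Finset.mem_image.1 ha
    exact fun h => hsucc i hi y hyD h.symm
  · intro a ha
    obtain ⟨i, hi, rfl⟩ := Finset.mem_image.1 ha
    exact fun h => hsucc i hi z hzD h.symm
  · intro h
    obtain ⟨i, -, hi⟩ := Finset.mem_image.1 h
    exact hy _ hi
  · intro h
    obtain ⟨i, -, hi⟩ := Finset.mem_image.1 h
    exact hz _ hi

end Frame

/-! ### The neighbours of `x` and their successors -/

/-- A frame in a `(P₂ ∪ kP₁)`-free graph whose outer vertices are independent and whose
distinguished outer vertex has degree at least `k`. -/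
structure Config [Fintype V] (G : SimpleGraph V) [DecidableRel G.Adj] (k n : ℕ) (c : ℕ → V) (x : V) :
    Prop extends Frame G n c x where
  two_le : 2 ≤ k
  free : G.IsInducedFree (edgeUnionIsolated k)
  outer : ∀ y z, (∀ i, c i ≠ y) → (∀ i, c i ≠ z) → ¬ G.Adj y z
  le_degree : k ≤ G.degree x

/-- Indices of the neighbours of `x` on the cycle. -/
def nbrIdx (G : SimpleGraph V) [DecidableRel G.Adj] (n : ℕ) (c : ℕ → V) (x : V) : Finset ℕ :=
  (Finset.range n).filter fun i => G.Adj x (c i)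

/-- Indices of those neighbours of `x` on the cycle whose successor is adjacent to `u`. -/
def succIdx (G : SimpleGraph V) [DecidableRel G.Adj] (n : ℕ) (c : ℕ → V) (x u : V) : Finset ℕ :=
  (nbrIdx G n c x).filter fun i => G.Adj u (c (i + 1))

/-- The vertex `x` together with the successors of its neighbours on the cycle. -/
def succSet [DecidableEq V] (G : SimpleGraph V) [DecidableRel G.Adj] (n : ℕ) (c : ℕ → V) (x : V) :
    Finset V :=
  insert x ((nbrIdx G n c x).image fun i => c (i + 1))

section

variable [DecidableRel G.Adj] {n : ℕ} {c : ℕ → V} {x : V}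

lemma mem_nbrIdx {i : ℕ} : i ∈ nbrIdx G n c x ↔ i < n ∧ G.Adj x (c i) := by
  simp [nbrIdx]

lemma mem_succIdx {i : ℕ} {u : V} :
    i ∈ succIdx G n c x u ↔ (i < n ∧ G.Adj x (c i)) ∧ G.Adj u (c (i + 1)) := by
  simp [succIdx, mem_nbrIdx]

lemma mem_succSet [DecidableEq V] {v : V} :
    v ∈ succSet G n c x ↔ v = x ∨ ∃ i, i < n ∧ G.Adj x (c i) ∧ c (i + 1) = v := by
  simp [succSet, mem_nbrIdx, and_assoc]

end

namespace Frame

variable {n : ℕ} {c : ℕ → V} {x : V}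

lemma mem_succSet_iff [DecidableEq V] [DecidableRel G.Adj] (F : Frame G n c x) {v : V} :
    v ∈ succSet G n c x ↔ v = x ∨ ∃ i, G.Adj x (c i) ∧ c (i + 1) = v := by
  rw [mem_succSet]
  refine or_congr Iff.rfl ⟨fun ⟨i, _, h⟩ => ⟨i, h⟩, fun ⟨i, h, hv⟩ => ?_⟩
  refine ⟨i % n, Nat.mod_lt _ (by have := F.three_le; omega), by rwa [F.mod_eq], ?_⟩
  rw [← hv, ← F.mod_eq (i % n + 1), ← F.mod_eq (i + 1)]
  simp

/-- The set of successors does not depend on the starting point of the cycle. -/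
lemma succSet_rotate [DecidableEq V] [DecidableRel G.Adj] (F : Frame G n c x) (r : ℕ) :
    succSet G n (fun i => c (i + r)) x = succSet G n c x := by
  ext v
  rw [(F.rotate r).mem_succSet_iff, F.mem_succSet_iff]
  refine or_congr Iff.rfl ⟨fun ⟨i, h, hv⟩ => ⟨i + r, h, ?_⟩, fun ⟨i, h, hv⟩ => ?_⟩
  · rw [← hv, add_right_comm]
  · have h3 := F.three_le
    -- Adding `r * (n - 1)` undoes the shift by `r` modulo `n` without subtraction.
    have hi : i + r * (n - 1) + r = i + n * r := by
      obtain ⟨m, rfl⟩ : ∃ m, n = m + 1 := ⟨n - 1, by omega⟩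
      simp only [Nat.add_sub_cancel]
      ring
    refine ⟨i + r * (n - 1), ?_, ?_⟩
    · rwa [hi, F.periodic_mul]
    · rw [add_right_comm, hi, add_right_comm, F.periodic_mul, hv]

/-- The neighbours of `x` are not consecutive on a longest cycle. -/
lemma not_adj_succ (F : Frame G n c x) {i : ℕ} (h : G.Adj x (c i)) : ¬ G.Adj x (c (i + 1)) :=
  fun h' => F.no_detour_succ i (Walk.nil : G.Walk x x) (by simp) (by simpa using F.ne) h.symm h'

/-- The successors of the neighbours of `x` are independent. -/
lemma not_adj_succ_succ (F : Frame G n c x) {i j : ℕ} (hi : i < n) (hj : j < n)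
    (hxi : G.Adj x (c i)) (hxj : G.Adj x (c j)) : ¬ G.Adj (c (i + 1)) (c (j + 1)) := by
  have key : ∀ i j, i < j → j < n → G.Adj x (c i) → G.Adj x (c j) →
      ¬ G.Adj (c (i + 1)) (c (j + 1)) := fun i j hij hj hxi hxj =>
    F.no_detour_cross hij hj (Walk.nil : G.Walk x x) (by simp) (by simpa using F.ne) hxj.symm hxi
  rcases Nat.lt_trichotomy i j with h | h | h
  · exact key i j h hj hxi hxj
  · rw [h]
    exact G.loopless.irrefl _
  · exact fun hadj => key j i h hi hxj hxi hadj.symm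

lemma succSet_indep [DecidableEq V] [DecidableRel G.Adj] (F : Frame G n c x) :
    G.IsIndepSet (succSet G n c x : Set V) := by
  intro a ha b hb hab hadj
  rcases mem_succSet.1 (Finset.mem_coe.1 ha) with rfl | ⟨i, hi, hxi, rfl⟩
  · rcases mem_succSet.1 (Finset.mem_coe.1 hb) with rfl | ⟨j, hj, hxj, rfl⟩
    · exact hab rfl
    · exact F.not_adj_succ hxj hadj
  · rcases mem_succSet.1 (Finset.mem_coe.1 hb) with rfl | ⟨j, hj, hxj, rfl⟩
    · exact F.not_adj_succ hxi hadj.symm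
    · exact F.not_adj_succ_succ hi hj hxi hxj hadj

lemma succ_injOn (F : Frame G n c x) {s : Set ℕ} (hs : ∀ i ∈ s, i < n) :
    Set.InjOn (fun i => c (i + 1)) s := fun i hi j hj h =>
  (F.rotate 1).inj i (hs i hi) j (hs j hj) h

lemma card_filter_succSet [DecidableEq V] [DecidableRel G.Adj] (F : Frame G n c x) (u : V) :
    ((succSet G n c x).filter fun s => G.Adj u s).card =
      (succIdx G n c x u).card + if G.Adj u x then 1 else 0 := by
  have himg : ((nbrIdx G n c x).image fun i => c (i + 1)).filter (fun s => G.Adj u s) =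
      (succIdx G n c x u).image fun i => c (i + 1) := by
    rw [Finset.filter_image]
    rfl
  have hcard : ((succIdx G n c x u).image fun i => c (i + 1)).card = (succIdx G n c x u).card :=
    Finset.card_image_of_injOn (F.succ_injOn fun i hi => (mem_succIdx.1 (Finset.mem_coe.1 hi)).1.1)
  rw [succSet, Finset.filter_insert]
  split_ifs with h
  · rw [Finset.card_insert_of_notMem, himg, hcard]
    intro hx
    obtain ⟨i, -, hi⟩ := Finset.mem_image.1 (Finset.mem_filter.1 hx).1
    exact F.ne _ hi
  · rw [himg, hcard, add_zero]

lemma card_succSet [DecidableEq V] [DecidableRel G.Adj] (F : Frame G n c x) :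
    (succSet G n c x).card = (nbrIdx G n c x).card + 1 := by
  rw [succSet, Finset.card_insert_of_notMem, Finset.card_image_of_injOn]
  · exact F.succ_injOn fun i hi => (mem_nbrIdx.1 (Finset.mem_coe.1 hi)).1
  · intro hx
    obtain ⟨i, -, hi⟩ := Finset.mem_image.1 hx
    exact F.ne _ hi

/-- A path missing just one vertex of the cycle and joining two neighbours of `x` gives a longest
cycle through `x` that misses that vertex. -/
lemma exists_frame_of_run (F : Frame G n c x) {a b m r : ℕ} {s : Set ℕ} (hr : r < n)
    (ha : G.Adj x (c a)) (hb : G.Adj x (c b)) (h : Run G c a b m s) (hm : m + 1 = n)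
    (hs : ∀ i < n, i ≠ r → i ∈ s) : ∃ c', Frame G n c' (c r) := by
  classical
  obtain ⟨p, hp, hps⟩ := h
  have h3 := F.three_le
  have hx : x ∉ ((Finset.range n).erase r).image c := by
    intro h
    obtain ⟨i, -, hi⟩ := Finset.mem_image.1 h
    exact F.ne i hi
  have hcard : (insert x (((Finset.range n).erase r).image c)).card = n := by
    rw [Finset.card_insert_of_notMem hx, Finset.card_image_of_injOn,
      Finset.card_erase_of_mem (Finset.mem_range.2 hr), Finset.card_range]
    · omega
    · intro i hi j hj h
      have hi := (Finset.mem_erase.1 (Finset.mem_coe.1 hi)).2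
      have hj := (Finset.mem_erase.1 (Finset.mem_coe.1 hj)).2
      exact F.inj i (Finset.mem_range.1 hi) j (Finset.mem_range.1 hj) h
  obtain ⟨hpath, hsub⟩ := (Walk.cons ha p).isPath_of_card_le (T := insert x
      (((Finset.range n).erase r).image c)) (by
      intro t ht
      rw [Walk.support_cons]
      rcases Finset.mem_insert.1 ht with rfl | ht
      · simp
      · obtain ⟨i, hi, rfl⟩ := Finset.mem_image.1 ht
        obtain ⟨hir, hi⟩ := Finset.mem_erase.1 hi
        exact List.mem_cons_of_mem _ (hps i (hs i (Finset.mem_range.1 hi) hir))) (by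
      rw [hcard]
      simp only [Walk.length_support, Walk.length_cons] at *
      omega)
  have hlen : (Walk.cons hb.symm (Walk.cons ha p)).length = n := by
    simp only [Walk.length_support, Walk.length_cons] at *
    omega
  have hcyc := hpath.cons_isCycle_of_two_le hb.symm (by
    simp only [Walk.length_cons] at hlen ⊢
    omega)
  have hnot : ∀ w ∈ (Walk.cons ha p).support, w ≠ c r := by
    rintro w hw rfl
    rcases Finset.mem_insert.1 (hsub _ hw) with h | h
    · exact F.ne _ h
    · obtain ⟨i, hi, hir⟩ := Finset.mem_image.1 h
      obtain ⟨hne, hi⟩ := Finset.mem_erase.1 hi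
      exact hne (F.inj i (Finset.mem_range.1 hi) r hr hir)
  have hmiss : c r ∉ (Walk.cons hb.symm (Walk.cons ha p)).support := by
    intro h
    rw [Walk.support_cons, List.mem_cons] at h
    rcases h with h | h
    · refine hnot (c b) ?_ h.symm
      rw [Walk.support_cons]
      exact List.mem_cons_of_mem _ p.end_mem_support
    · exact hnot _ h rfl
  have hmax : ∀ u (q' : G.Walk u u), q'.IsCycle →
      q'.length ≤ (Walk.cons hb.symm (Walk.cons ha p)).length := by
    rw [hlen]
    exact F.max
  have hframe := hcyc.frame hmax hmiss
  rw [hlen] at hframe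
  exact ⟨_, hframe⟩

end Frame

namespace Config

variable [Fintype V] [DecidableRel G.Adj] {k n : ℕ} {c : ℕ → V} {x : V}

lemma rotate (F : Config G k n c x) (r : ℕ) : Config G k n (fun i => c (i + r)) x where
  toFrame := F.toFrame.rotate r
  two_le := F.two_le
  free := F.free
  outer y z hy hz := by
    have hsurj : ∀ i, ∃ j, c (j + r) = c i := fun i => by
      have h3 := F.three_le
      refine ⟨i + r * (n - 1), ?_⟩
      have hi : i + r * (n - 1) + r = i + n * r := by
        obtain ⟨m, rfl⟩ : ∃ m, n = m + 1 := ⟨n - 1, by omega⟩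
        simp only [Nat.add_sub_cancel]
        ring
      rw [hi, F.periodic_mul]
    refine F.outer y z (fun i hi => ?_) (fun i hi => ?_)
    · obtain ⟨j, hj⟩ := hsurj i
      exact hy j (hj.trans hi)
    · obtain ⟨j, hj⟩ := hsurj i
      exact hz j (hj.trans hi)
  le_degree := F.le_degree

lemma exists_idx_of_adj (F : Config G k n c x) {v : V} (h : G.Adj x v) : ∃ i < n, c i = v := by
  by_contra! hv
  refine F.outer x v F.ne (fun i hi => ?_) h
  obtain ⟨j, hj, hji⟩ := F.exists_lt_eq i
  exact hv j hj (hji.trans hi)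

lemma card_nbrIdx (F : Config G k n c x) : (nbrIdx G n c x).card = G.degree x := by
  classical
  rw [← card_neighborFinset_eq_degree, ← Finset.card_image_of_injOn (f := c) (s := nbrIdx G n c x)]
  · congr 1
    ext v
    simp only [Finset.mem_image, mem_nbrIdx, mem_neighborFinset]
    refine ⟨?_, fun h => ?_⟩
    · rintro ⟨i, ⟨-, h⟩, rfl⟩
      exact h
    · obtain ⟨i, hi, rfl⟩ := F.exists_idx_of_adj h
      exact ⟨i, ⟨hi, h⟩, rfl⟩
  · intro i hi j hj h
    exact F.inj i (mem_nbrIdx.1 (Finset.mem_coe.1 hi)).1 j (mem_nbrIdx.1 (Finset.mem_coe.1 hj)).1 h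

section

variable [DecidableEq V]

/-- A vertex with a neighbour among the successors has many of them. -/
lemma le_card_filter (F : Config G k n c x) {u s : V} (hs : s ∈ succSet G n c x) (hus : G.Adj u s) :
    G.degree x + 2 ≤ ((succSet G n c x).filter fun s => G.Adj u s).card + k := by
  have h1 := F.free.card_filter_not_adj_lt F.succSet_indep hs hus
  have h2 := Finset.card_filter_add_card_filter_not (s := succSet G n c x) (fun s => G.Adj u s)
  rw [F.card_succSet, F.card_nbrIdx] at h2
  omega

/-- One is lost against `le_card_filter` because `x` itself may be among the neighbours counted
there. Non-adjacency to `x` recovers it, which is why later arguments first show that a vertex is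
not in N(x). -/
lemma le_card_succIdx (F : Config G k n c x) {u s : V} (hs : s ∈ succSet G n c x)
    (hus : G.Adj u s) : G.degree x + 1 ≤ (succIdx G n c x u).card + k := by
  have h1 := F.le_card_filter hs hus
  rw [F.card_filter_succSet] at h1
  split_ifs at h1 <;> omega

lemma le_card_succIdx_of_not_adj (F : Config G k n c x) {u s : V} (hs : s ∈ succSet G n c x)
    (hus : G.Adj u s) (hux : ¬ G.Adj u x) :
    G.degree x + 2 ≤ (succIdx G n c x u).card + k := by
  have h1 := F.le_card_filter hs hus
  rw [F.card_filter_succSet, if_neg hux] at h1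
  omega

/-- Two vertices without neighbours among the successors are not adjacent. -/
lemma not_adj_of_forall (F : Config G k n c x) {u v : V}
    (hu : ∀ s ∈ succSet G n c x, ¬ G.Adj u s) (hv : ∀ s ∈ succSet G n c x, ¬ G.Adj v s) :
    ¬ G.Adj u v := by
  intro huv
  have h1 := F.free.card_lt huv (succSet G n c x) F.succSet_indep hu hv
    (fun h => hv _ h huv.symm) (fun h => hu _ h huv)
  rw [F.card_succSet, F.card_nbrIdx] at h1
  have := F.le_degree
  omega

lemma mem_succSet_of_adj (_F : Config G k n c x) {i : ℕ} (hi : i < n) (h : G.Adj x (c i)) :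
    c (i + 1) ∈ succSet G n c x :=
  mem_succSet.2 (Or.inr ⟨i, hi, h, rfl⟩)

/-- The successors have no neighbours outside the cycle. -/
lemma exists_idx_of_adj_succSet (F : Config G k n c x) (hlast : ¬ G.Adj x (c (n - 1))) {u s : V}
    (hs : s ∈ succSet G n c x) (hus : G.Adj u s) : ∃ i < n, c i = u := by
  by_contra! hu
  have hout : ∀ i, c i ≠ u := fun i hi => by
    obtain ⟨j, hj, hji⟩ := F.exists_lt_eq i
    exact hu j hj (hji.trans hi)
  have hux : ¬ G.Adj u x := F.outer u x hout F.ne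
  have h1 := F.le_card_succIdx_of_not_adj hs hus hux
  have h2 := F.le_degree
  have hxu : x ≠ u := by
    rintro rfl
    obtain rfl | ⟨i, -, hxi, rfl⟩ := mem_succSet.1 hs
    · exact G.loopless.irrefl _ hus
    · exact F.not_adj_succ hxi hus
  -- Two such indices cut the cycle into the arc from c_{i+1} to c_j and its complement. These are
  -- rejoined through `x` at c_i, c_j and through `u` at c_{i+1}, c_{j+1}, giving a cycle with two
  -- more vertices.
  have key : ∀ i j, i < j → i ∈ succIdx G n c x u → j ∈ succIdx G n c x u → False := by
    intro i j hij hi hj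
    obtain ⟨⟨hin, hxi⟩, hui⟩ := mem_succIdx.1 hi
    obtain ⟨⟨hjn, hxj⟩, huj⟩ := mem_succIdx.1 hj
    have hj' : j ≠ n - 1 := fun h => hlast (h ▸ hxj)
    refine F.not_run_two hxu hout (F.up (i := i + 1) (j := j) (by omega)) hxj hxi
      ((F.down (i := 0) (j := i) (by omega)).append F.wrap.symm
        (F.down (i := j + 1) (j := n - 1) (by omega))) huj hui (by omega) ?_
    intro l hl
    simp only [Set.mem_union, Set.mem_Icc]
    omega
  obtain ⟨i, hi, j, hj, hij⟩ := Finset.one_lt_card.1 (show 1 < (succIdx G n c x u).card by omega)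
  rcases Nat.lt_or_gt_of_ne hij with h | h
  · exact key i j h hi hj
  · exact key j i h hj hi

omit [DecidableEq V] in
/-- Each successor of a neighbour of `x` can be exchanged with `x`. -/
lemma exists_frame_succ (F : Config G k n c x) {i : ℕ} (hxi : G.Adj x (c i)) :
    ∃ c', Frame G n c' (c (i + 1)) := by
  classical
  have key : ∀ c, Config G k n c x → G.Adj x (c 0) → ∃ c', Frame G n c' (c 1) := by
    intro c F hx0
    have h3 := F.three_le
    have hlast : ¬ G.Adj x (c (n - 1)) := by
      intro h
      refine F.not_adj_succ h ?_
      rwa [Nat.sub_add_cancel (by omega), F.zero_eq]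
    -- If `x` is adjacent to `c 2`, it simply replaces `c 1`. Otherwise `c 2` has at least d + 2 - k
    -- ≥ 2 neighbours among the successors, and one other than `c 1` provides a chord that bypasses
    -- `c 1`.
    by_cases hx2 : G.Adj x (c 2)
    · have hn : n ≠ 3 := by
        rintro rfl
        exact hlast hx2
      refine F.exists_frame_of_run (r := 1) (by omega) hx2 hx0
        ((F.up (i := 2) (j := n - 1) (by omega)).append F.wrap (F.one 0)) (by omega) ?_
      intro l hl hl1
      simp only [Set.mem_union, Set.mem_Icc, Set.mem_singleton_iff]
      omega
    · have h1 := F.le_card_succIdx_of_not_adj (F.mem_succSet_of_adj (by omega) hx0)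
        (F.adj 1).symm (fun h => hx2 h.symm)
      have h2 := F.le_degree
      obtain ⟨j, hj, hj0⟩ := Finset.exists_mem_ne
        (show 1 < (succIdx G n c x (c (1 + 1))).card by omega) 0
      obtain ⟨⟨hjn, hxj⟩, huj⟩ := mem_succIdx.1 hj
      have hj1 : j ≠ 1 := by
        rintro rfl
        exact F.not_adj_succ hx0 hxj
      have hj2 : j ≠ 2 := fun h => hx2 (h ▸ hxj)
      have hj' : j ≠ n - 1 := fun h => hlast (h ▸ hxj)
      refine F.exists_frame_of_run (r := 1) (by omega) hx0 hxj
        (((F.one 0).append F.wrap.symm (F.down (i := j + 1) (j := n - 1) (by omega))).append huj.symm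
          (F.up (i := 2) (j := j) (by omega))) (by omega) ?_
      intro l hl hl1
      simp only [Set.mem_union, Set.mem_Icc, Set.mem_singleton_iff]
      omega
  have := key _ (F.rotate i) (by simpa using hxi)
  simpa [add_comm] using this

end

end Config

/-! ### Choosing the missed vertex with large degree -/

lemma dist_eq_two_of_adj {a b v : V} (hab : G.Adj a b) (hbv : G.Adj b v) (hne : a ≠ v)
    (hnot : ¬ G.Adj a v) : G.dist a v = 2 := by
  have hr : G.Reachable a v := hab.reachable.trans hbv.reachable
  have h1 : G.dist a v ≤ 2 := dist_le (Walk.cons hab (Walk.cons hbv Walk.nil))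
  have h2 : 0 < G.dist a v := hr.pos_dist_of_ne hne
  have h3 : G.dist a v ≠ 1 := fun h => hnot (dist_eq_one_iff_adj.1 h)
  omega

/-- The maximum degree over the nonempty set `S` is attained, so the bound on μ passes to a single
vertex. It is stated without division to suit integer arithmetic. -/
lemma exists_le_degree_of_essentialMu [Fintype V] [DecidableRel G.Adj] {k : ℕ}
    (hmu : (((7 * (k : ℝ) - 6) / 5 : ℝ) : EReal) ≤
      ((G.essentialMu (k + 1) : ENNReal) : EReal))
    {S : Finset V} (hS : G.IsEssentialIndepSet (k + 1) S) :
    ∃ v ∈ S, 7 * k ≤ 5 * G.degree v + 6 := by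
  have h1 : G.essentialMu (k + 1) ≤ ((S.sup fun x => G.degree x : ℕ) : ℕ∞) :=
    iInf_le (fun S : {S : Finset V // G.IsEssentialIndepSet (k + 1) S} =>
      ((S.1.sup fun x => G.degree x : ℕ) : ℕ∞)) ⟨S, hS⟩
  have h2 : ((G.essentialMu (k + 1) : ENNReal) : EReal) ≤
      ((((S.sup fun x => G.degree x : ℕ) : ℝ)) : EReal) := by
    have h3 : (G.essentialMu (k + 1) : ENNReal) ≤ ((S.sup fun x => G.degree x : ℕ) : ENNReal) := by
      exact_mod_cast ENat.toENNReal_le.2 h1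
    calc ((G.essentialMu (k + 1) : ENNReal) : EReal)
        ≤ (((S.sup fun x => G.degree x : ℕ) : ENNReal) : EReal) := EReal.coe_ennreal_le_coe_ennreal_iff.2 h3
      _ = _ := by
        rw [← ENNReal.ofReal_natCast, EReal.coe_ennreal_ofReal, max_eq_left (Nat.cast_nonneg _)]
  have h3 := EReal.coe_le_coe_iff.1 (hmu.trans h2)
  have hne : S.Nonempty := by
    obtain ⟨y, -, -, hy, -⟩ := hS
    exact ⟨y, hy⟩
  obtain ⟨v, hv, hvs⟩ := Finset.exists_mem_eq_sup S hne fun x => G.degree x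
  refine ⟨v, hv, ?_⟩
  rw [hvs] at h3
  have h4 : (7 * (k : ℝ)) ≤ 5 * (G.degree v : ℝ) + 6 := by linarith
  exact_mod_cast h4

/-- A non-hamiltonian graph satisfying the hypotheses has a longest cycle missing a vertex of large
degree. -/
lemma exists_config [Fintype V] [DecidableEq V] [DecidableRel G.Adj] {k : ℕ} (hk : 2 ≤ k)
    (hconn : G.IsVertexConnected k) (hfree : G.IsInducedFree (edgeUnionIsolated k))
    (hmu : (((7 * (k : ℝ) - 6) / 5 : ℝ) : EReal) ≤
      ((G.essentialMu (k + 1) : ENNReal) : EReal)) (hham : ¬ G.IsHamiltonian) :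
    ∃ n c x, Config G k n c x ∧ 7 * k ≤ 5 * G.degree x + 6 := by
  obtain ⟨n, c, x, F⟩ := hconn.exists_frame hk hham
  have hF : ∀ {n c x}, Frame G n c x → Config G k n c x := fun F =>
    { F with
      two_le := hk
      free := hfree
      outer := fun y z hy hz => F.outer_not_adj hconn hfree hy hz
      le_degree := hconn.le_degree _ }
  have C := hF F
  have hcard : k ≤ ((nbrIdx G n c x).image fun i => c (i + 1)).card := by
    rw [Finset.card_image_of_injOn
      (F.succ_injOn fun i hi => (mem_nbrIdx.1 (Finset.mem_coe.1 hi)).1), C.card_nbrIdx]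
    exact C.le_degree
  obtain ⟨K, hK, hKk⟩ := Finset.exists_subset_card_eq hcard
  have hsub : insert x K ⊆ succSet G n c x := Finset.insert_subset_insert _ hK
  have hess : G.IsEssentialIndepSet (k + 1) (insert x K) := by
    refine ⟨x, fun a ha b hb => F.succSet_indep (hsub ha) (hsub hb), ?_, by simp, ?_⟩
    · rw [Finset.card_insert_of_notMem, hKk]
      intro hx
      obtain ⟨i, -, hi⟩ := Finset.mem_image.1 (hK hx)
      exact F.ne _ hi
    · intro v hv hvx
      obtain ⟨i, hi, rfl⟩ := Finset.mem_image.1 (hK (Finset.mem_of_mem_insert_of_ne hv hvx))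
      have hxi := (mem_nbrIdx.1 hi).2
      exact dist_eq_two_of_adj hxi (F.adj i) hvx.symm (F.not_adj_succ hxi)
  obtain ⟨v, hv, hdeg⟩ := exists_le_degree_of_essentialMu hmu hess
  obtain rfl | ⟨i, -, hxi, rfl⟩ := mem_succSet.1 (hsub hv)
  · exact ⟨n, c, _, C, hdeg⟩
  · obtain ⟨c', F'⟩ := C.exists_frame_succ hxi
    exact ⟨n, c', _, hF F', hdeg⟩

/-! ### Toughness and the choice of a starting point -/

lemma numComponents_eq_card {W : Type*} (H : SimpleGraph W) (hH : ∀ a b, ¬ H.Adj a b) :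
    H.numComponents = Nat.card W := by
  have hbot : H = ⊥ := by
    ext a b
    simp [hH]
  subst hbot
  refine (Nat.card_congr (Equiv.ofBijective (connectedComponentMk ⊥) ⟨?_, ?_⟩)).symm
  · intro a b hab
    simpa using ConnectedComponent.exact hab
  · exact fun C => C.exists_rep

/-- Sets ordered in this way share at most one element. All counts of attachment sets inside X rest
on this. -/
lemma card_add_card_le_of_forall_le {A B : Finset ℕ} (h : ∀ a ∈ A, ∀ b ∈ B, a ≤ b) :
    A.card + B.card ≤ (A ∪ B).card + 1 := by
  have h1 : (A ∩ B).card ≤ 1 := by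
    rw [Finset.card_le_one]
    intro a ha b hb
    rw [Finset.mem_inter] at ha hb
    exact le_antisymm (h a ha.1 b hb.2) (h b hb.1 a ha.2)
  have := Finset.card_union_add_card_inter A B
  omega

namespace Config

variable [Fintype V] [DecidableEq V] [DecidableRel G.Adj] {k n : ℕ} {c : ℕ → V} {x : V}

/-- By toughness, some two consecutive vertices of the cycle have neighbours among the
successors. -/
lemma exists_consecutive (F : Config G k n c x) (htough : G.IsTough 1) :
    ∃ i, (∃ s ∈ succSet G n c x, G.Adj (c i) s) ∧ ∃ s ∈ succSet G n c x, G.Adj (c (i + 1)) s := by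
  have key : ∀ c, Config G k n c x → G.Adj x (c 0) →
    ∃ i, (∃ s ∈ succSet G n c x, G.Adj (c i) s) ∧ ∃ s ∈ succSet G n c x, G.Adj (c (i + 1)) s := by
    intro c F hx0
    by_contra! hno
    have h3 := F.three_le
    have hlast : ¬ G.Adj x (c (n - 1)) := by
      intro h
      refine F.not_adj_succ h ?_
      rwa [Nat.sub_add_cancel (by omega), F.zero_eq]
    let T : Finset V := Finset.univ.filter fun u => ∃ s ∈ succSet G n c x, G.Adj u s
    have hmem : ∀ u, u ∉ T → ∀ s ∈ succSet G n c x, ¬ G.Adj u s := by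
      intro u hu s hs hus
      exact hu (Finset.mem_filter.2 ⟨Finset.mem_univ _, s, hs, hus⟩)
    have hST : ∀ s ∈ succSet G n c x, s ∉ T := by
      intro s hs hsT
      obtain ⟨-, s', hs', hadj⟩ := Finset.mem_filter.1 hsT
      exact F.succSet_indep hs hs' hadj.ne hadj
    -- Removing `T` leaves no edges, so toughness compares |T| with the number of vertices outside
    -- `T`.
    have hind : ∀ a b, ¬ (G.induce ((T : Set V)ᶜ)).Adj a b := by
      intro a b hab
      exact F.not_adj_of_forall (hmem a fun h => a.2 h) (hmem b fun h => b.2 h)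
        (by simpa using hab)
    have hxT : x ∉ T := hST x (mem_succSet.2 (Or.inl rfl))
    have h1T : c 1 ∉ T := hST (c 1) (F.mem_succSet_of_adj (by omega) hx0)
    have hcut : G.IsVertexCut T := by
      intro hpre
      obtain ⟨p⟩ := hpre ⟨x, by simpa using hxT⟩ ⟨c 1, by simpa using h1T⟩
      cases p with
      | nil => exact F.ne 1 rfl
      | cons h _ => exact hind _ _ h
    have h1 := htough T hcut
    rw [numComponents_eq_card _ hind, one_mul, Nat.cast_le] at h1
    have hcard : Nat.card ((T : Set V)ᶜ : Set V) = Tᶜ.card := by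
      rw [Nat.card_eq_fintype_card, ← Set.toFinset_card]
      congr 1
      ext v
      simp
    rw [hcard] at h1
    -- `T` lies on the cycle. If no two consecutive vertices belong to `T`, shifting by one injects
    -- `T` into its complement, and the image misses `x`.
    have hlt : T.card < Tᶜ.card := by
      have hidx : ∀ u ∈ T, ∃ i < n, c i = u := by
        intro u hu
        obtain ⟨-, s, hs, hus⟩ := Finset.mem_filter.1 hu
        exact F.exists_idx_of_adj_succSet hlast hs hus
      choose! f hfn hf using hidx
      have h2 : (T.image fun u => c (f u + 1)).card = T.card := by
        refine Finset.card_image_of_injOn fun u hu v hv huv => ?_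
        rw [← hf u hu, ← hf v hv, F.succ_injOn (s := {i | i < n}) (fun i hi => hi) (hfn u hu)
          (hfn v hv) huv]
      rw [← h2]
      refine Finset.card_lt_card ⟨fun w hw => ?_, fun h => ?_⟩
      · obtain ⟨u, hu, rfl⟩ := Finset.mem_image.1 hw
        rw [Finset.mem_compl]
        intro hmem'
        obtain ⟨-, s, hs, hus⟩ := Finset.mem_filter.1 hu
        obtain ⟨-, s', hs', hus'⟩ := Finset.mem_filter.1 hmem'
        exact hno (f u) ⟨s, hs, by rwa [hf u hu]⟩ s' hs' hus'
      · obtain ⟨u, -, hu⟩ := Finset.mem_image.1 (h (Finset.mem_compl.2 hxT))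
        exact F.ne _ hu
    omega
  obtain ⟨j, hj⟩ : (nbrIdx G n c x).Nonempty := by
    rw [← Finset.card_pos, F.card_nbrIdx]
    have := F.le_degree
    have := F.two_le
    omega
  obtain ⟨i, h1, h2⟩ := key _ (F.rotate j) (by simpa using (mem_nbrIdx.1 hj).2)
  rw [F.succSet_rotate] at h1 h2
  refine ⟨i + j, h1, ?_⟩
  rwa [add_right_comm] at h2

omit [DecidableEq V] in
/-- Successors adjacent to the first vertex of the cycle precede those adjacent to the last one. -/
lemma le_of_mem_succIdx (F : Config G k n c x) (hlast : ¬ G.Adj x (c (n - 1))) {i j : ℕ}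
    (hi : i ∈ succIdx G n c x (c 0)) (hj : j ∈ succIdx G n c x (c (n - 1))) : i ≤ j := by
  by_contra! hji
  obtain ⟨⟨hin, hxi⟩, hui⟩ := mem_succIdx.1 hi
  obtain ⟨⟨hjn, hxj⟩, huj⟩ := mem_succIdx.1 hj
  have hi' : i ≠ n - 1 := fun h => hlast (h ▸ hxi)
  refine F.not_run hxj hxi (((F.down (i := 0) (j := j) (by omega)).append hui
    (F.up (i := i + 1) (j := n - 1) (by omega))).append huj
    (F.up (i := j + 1) (j := i) (by omega))) (by omega) ?_
  intro l hl
  simp only [Set.mem_union, Set.mem_Icc]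
  omega

/-- If no predecessor of a neighbour of `x` has a neighbour among the successors, then consecutive
vertices with neighbours among the successors are adjacent to `x`. -/
lemma false_of_forall_pred (F : Config G k n c x) (hbound : 7 * k ≤ 5 * G.degree x + 6)
    (hlast : ¬ G.Adj x (c (n - 1))) (hx0 : ¬ G.Adj x (c 0))
    (hw0 : ∃ s ∈ succSet G n c x, G.Adj (c 0) s)
    (hw1 : ∃ s ∈ succSet G n c x, G.Adj (c (n - 1)) s)
    (hpred : ∀ i ∈ nbrIdx G n c x, ∀ s ∈ succSet G n c x, ¬ G.Adj (c (i - 1)) s) : False := by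
  have h3 := F.three_le
  have hk := F.two_le
  have hd := F.le_degree
  have hpos : ∀ i ∈ nbrIdx G n c x, 0 < i ∧ i < n - 1 ∧ G.Adj x (c i) := by
    intro i hi
    obtain ⟨hin, hxi⟩ := mem_nbrIdx.1 hi
    refine ⟨Nat.pos_of_ne_zero ?_, ?_, hxi⟩
    · rintro rfl
      exact hx0 hxi
    · have : i ≠ n - 1 := fun h => hlast (h ▸ hxi)
      omega
  -- The mirror image of `succSet`, built from predecessors. It is independent for the same reason.
  let T : Finset V := insert x ((nbrIdx G n c x).image fun i => c (i - 1))
  have hxT : ∀ i ∈ nbrIdx G n c x, ¬ G.Adj x (c (i - 1)) := by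
    intro i hi h
    obtain ⟨h0, -, hxi⟩ := hpos i hi
    have := F.not_adj_succ h
    rw [Nat.sub_add_cancel h0] at this
    exact this hxi
  have hlt : ∀ i ∈ nbrIdx G n c x, ∀ j ∈ nbrIdx G n c x, i < j →
      ¬ G.Adj (c (i - 1)) (c (j - 1)) := by
    intro i hi j hj hij hadj
    obtain ⟨hi0, hin, hxi⟩ := hpos i hi
    obtain ⟨hj0, hjn, hxj⟩ := hpos j hj
    refine F.not_run hxi hxj (((F.up (i := i) (j := j - 1) (by omega)).append hadj.symm
      (F.down (i := 0) (j := i - 1) (by omega))).append F.wrap.symm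
      (F.down (i := j) (j := n - 1) (by omega))) (by omega) ?_
    intro l hl
    simp only [Set.mem_union, Set.mem_Icc]
    omega
  have hTind : G.IsIndepSet (T : Set V) := by
    intro a ha b hb hab hadj
    rcases Finset.mem_insert.1 (Finset.mem_coe.1 ha) with rfl | ha
    · rcases Finset.mem_insert.1 (Finset.mem_coe.1 hb) with rfl | hb
      · exact hab rfl
      · obtain ⟨j, hj, rfl⟩ := Finset.mem_image.1 hb
        exact hxT j hj hadj
    · obtain ⟨i, hi, rfl⟩ := Finset.mem_image.1 ha
      rcases Finset.mem_insert.1 (Finset.mem_coe.1 hb) with rfl | hb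
      · exact hxT i hi hadj.symm
      · obtain ⟨j, hj, rfl⟩ := Finset.mem_image.1 hb
        rcases Nat.lt_trichotomy i j with h | h | h
        · exact hlt i hi j hj h hadj
        · exact hab (by rw [h])
        · exact hlt j hj i hi h hadj.symm
  have hinj : Set.InjOn (fun i => c (i - 1)) (nbrIdx G n c x : Set ℕ) := by
    intro i hi j hj h
    obtain ⟨hi0, hin, -⟩ := hpos i hi
    obtain ⟨hj0, hjn, -⟩ := hpos j hj
    have := F.inj _ (by omega) _ (by omega) h
    omega
  have hximg : x ∉ (nbrIdx G n c x).image fun i => c (i - 1) := by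
    intro h
    obtain ⟨i, -, hi⟩ := Finset.mem_image.1 h
    exact F.ne _ hi
  have hTcard : T.card = G.degree x + 1 := by
    rw [Finset.card_insert_of_notMem hximg, Finset.card_image_of_injOn hinj, F.card_nbrIdx]
  have hbig : ∀ w, (∃ s ∈ succSet G n c x, G.Adj w s) → ¬ G.Adj x w →
      G.degree x + 2 ≤ ((nbrIdx G n c x).filter fun i => G.Adj w (c (i - 1))).card + k := by
    rintro w ⟨s, hs, hws⟩ hxw
    have hSW : ∀ s ∈ succSet G n c x, ∀ s' ∈ succSet G n c x, ¬ G.Adj s s' :=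
      fun s hs s' hs' hadj => F.succSet_indep hs hs' hadj.ne hadj
    -- Otherwise the edge `w s` and the d + 1 > k vertices of `T` contain an induced P₂ ∪ kP₁;
    -- `hpred` separates `s` from the predecessors.
    obtain ⟨t, ht, hwt⟩ : ∃ t ∈ T, G.Adj w t := by
      by_contra! hno
      have := F.free.card_lt hws T hTind hno ?_ ?_ ?_
      · omega
      · intro t ht hst
        rcases Finset.mem_insert.1 ht with rfl | ht
        · exact hSW s hs _ (mem_succSet.2 (Or.inl rfl)) hst
        · obtain ⟨i, hi, rfl⟩ := Finset.mem_image.1 ht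
          exact hpred i hi s hs hst.symm
      · intro hwT
        rcases Finset.mem_insert.1 hwT with rfl | hwT
        · exact hSW _ (mem_succSet.2 (Or.inl rfl)) s hs hws
        · obtain ⟨i, hi, rfl⟩ := Finset.mem_image.1 hwT
          exact hpred i hi s hs hws
      · exact fun hsT => hno s hsT hws
    have h1 := F.free.card_filter_not_adj_lt hTind ht hwt
    have h2 := Finset.card_filter_add_card_filter_not (s := T) (fun t => G.Adj w t)
    have h4 : T.filter (fun t => G.Adj w t) =
        ((nbrIdx G n c x).filter fun i => G.Adj w (c (i - 1))).image fun i => c (i - 1) := by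
      rw [Finset.filter_insert, if_neg fun h => hxw h.symm, Finset.filter_image]
    rw [h4] at h2
    have h6 := Finset.card_image_le (f := fun i => c (i - 1))
      (s := (nbrIdx G n c x).filter fun i => G.Adj w (c (i - 1)))
    omega
  obtain ⟨s0, hs0, hws0⟩ := hw0
  obtain ⟨s1, hs1, hws1⟩ := hw1
  have c1 := hbig _ ⟨s0, hs0, hws0⟩ hx0
  have c2 := hbig _ ⟨s1, hs1, hws1⟩ hlast
  have c3 := F.le_card_succIdx_of_not_adj hs0 hws0 (fun h => hx0 h.symm)
  have c4 := F.le_card_succIdx_of_not_adj hs1 hws1 (fun h => hlast h.symm)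
  set P1 := (nbrIdx G n c x).filter fun i => G.Adj (c 0) (c (i - 1)) with hP1
  set P2 := (nbrIdx G n c x).filter fun i => G.Adj (c (n - 1)) (c (i - 1)) with hP2
  set N1 := succIdx G n c x (c 0) with hN1
  set N2 := succIdx G n c x (c (n - 1)) with hN2
  have l12 : ∀ i ∈ P1, ∀ j ∈ P2, i ≤ j := by
    intro i hi j hj
    by_contra! hji
    obtain ⟨hi, hui⟩ := Finset.mem_filter.1 hi
    obtain ⟨hj, huj⟩ := Finset.mem_filter.1 hj
    obtain ⟨hi0, hin, hxi⟩ := hpos i hi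
    obtain ⟨hj0, hjn, hxj⟩ := hpos j hj
    refine F.not_run hxj hxi (((F.up (i := j) (j := i - 1) (by omega)).append hui.symm
      (F.up (i := 0) (j := j - 1) (by omega))).append huj.symm
      (F.down (i := i) (j := n - 1) (by omega))) (by omega) ?_
    intro l hl
    simp only [Set.mem_union, Set.mem_Icc]
    omega
  have l23 : ∀ j ∈ P2, ∀ b ∈ N1, j ≤ b := by
    intro j hj b hb
    by_contra! hbj
    obtain ⟨hj, huj⟩ := Finset.mem_filter.1 hj
    obtain ⟨hj0, hjn, hxj⟩ := hpos j hj
    obtain ⟨⟨hbn, hxb⟩, hub⟩ := mem_succIdx.1 hb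
    have hne : b + 1 ≠ j := by
      rintro rfl
      exact F.not_adj_succ hxb hxj
    refine F.not_run hxj hxb (((F.up (i := j) (j := n - 1) (by omega)).append huj
      (F.down (i := b + 1) (j := j - 1) (by omega))).append hub.symm
      (F.up (i := 0) (j := b) (by omega))) (by omega) ?_
    intro l hl
    simp only [Set.mem_union, Set.mem_Icc]
    omega
  have l34 : ∀ b ∈ N1, ∀ a ∈ N2, b ≤ a := fun b hb a ha => F.le_of_mem_succIdx hlast hb ha
  obtain ⟨p2, hp2⟩ : P2.Nonempty := Finset.card_pos.1 (by omega)
  obtain ⟨n1, hn1⟩ : N1.Nonempty := Finset.card_pos.1 (by omega)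
  have e1 := card_add_card_le_of_forall_le l12
  have e2 : (P1 ∪ P2).card + N1.card ≤ _ := card_add_card_le_of_forall_le (by
    intro a ha b hb
    rcases Finset.mem_union.1 ha with ha | ha
    · exact (l12 a ha p2 hp2).trans (l23 p2 hp2 b hb)
    · exact l23 a ha b hb)
  have e3 : (P1 ∪ P2 ∪ N1).card + N2.card ≤ _ := card_add_card_le_of_forall_le (by
    intro a ha b hb
    rcases Finset.mem_union.1 ha with ha | ha
    · rcases Finset.mem_union.1 ha with ha | ha
      · exact ((l12 a ha p2 hp2).trans (l23 p2 hp2 n1 hn1)).trans (l34 n1 hn1 b hb)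
      · exact (l23 a ha n1 hn1).trans (l34 n1 hn1 b hb)
    · exact l34 a ha b hb)
  have e4 : (P1 ∪ P2 ∪ N1 ∪ N2).card ≤ (nbrIdx G n c x).card := by
    refine Finset.card_le_card ?_
    refine Finset.union_subset (Finset.union_subset (Finset.union_subset ?_ ?_) ?_) ?_ <;>
      exact Finset.filter_subset _ _
  -- Four sets of size at least d + 2 - k, successively ordered inside X, give 4(d + 2 - k) ≤ d + 3.
  -- This is incompatible with 5d ≥ 7k - 6.
  rw [F.card_nbrIdx] at e4
  omega

/-- There is a starting point of the cycle adjacent to `x` whose predecessor has a neighbour among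
the successors. -/
lemma exists_rotate (F : Config G k n c x) (htough : G.IsTough 1)
    (hbound : 7 * k ≤ 5 * G.degree x + 6) :
    ∃ c', Config G k n c' x ∧ G.Adj x (c' 0) ∧ ∃ s ∈ succSet G n c' x, G.Adj (c' (n - 1)) s := by
  have h3 := F.three_le
  by_contra! hno
  have hpred : ∀ i, G.Adj x (c (i + 1)) → ∀ s ∈ succSet G n c x, ¬ G.Adj (c i) s := by
    intro i hxi s hs
    have := hno _ (F.rotate (i + 1)) (by simpa using hxi) s (by rwa [F.succSet_rotate])
    have hi : n - 1 + (i + 1) = i + n := by omega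
    rwa [hi, F.periodic] at this
  obtain ⟨i, ⟨s, hs, his⟩, s', hs', his'⟩ := F.exists_consecutive htough
  have hxi : ¬ G.Adj x (c i) := by
    intro h
    have hmem : c (i + 1) ∈ succSet G n c x := F.mem_succSet_iff.2 (Or.inr ⟨i, h, rfl⟩)
    exact F.succSet_indep hmem hs' his'.ne his'
  have hxi' : ¬ G.Adj x (c (i + 1)) := fun h => hpred i h s hs his
  have hi : n - 1 + (i + 1) = i + n := by omega
  refine (F.rotate (i + 1)).false_of_forall_pred hbound ?_ ?_ ?_ ?_ ?_
  · rwa [hi, F.periodic]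
  · simpa using hxi'
  · rw [F.succSet_rotate]
    exact ⟨s', hs', by simpa using his'⟩
  · rw [F.succSet_rotate, hi, F.periodic]
    exact ⟨s, hs, his⟩
  · intro j hj t ht
    rw [F.succSet_rotate] at ht
    obtain ⟨hjn, hxj⟩ := mem_nbrIdx.1 hj
    have hj0 : j ≠ 0 := by
      rintro rfl
      exact hxi' (by simpa using hxj)
    refine hpred _ ?_ t ht
    have : j - 1 + (i + 1) + 1 = j + (i + 1) := by omega
    rwa [this]

end Config

/-! ### Rotations of the path from the first to the last vertex -/

/-- A configuration whose cycle starts at a neighbour of `x` and ends at a vertex with a neighbour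
among the successors. -/
structure Based [Fintype V] [DecidableEq V] (G : SimpleGraph V) [DecidableRel G.Adj] (k n : ℕ)
    (c : ℕ → V) (x : V) : Prop extends Config G k n c x where
  adj_zero : G.Adj x (c 0)
  adj_last : ∃ s ∈ succSet G n c x, G.Adj (c (n - 1)) s

namespace Based

variable [Fintype V] [DecidableEq V] [DecidableRel G.Adj] {k n : ℕ} {c : ℕ → V} {x : V}

lemma not_adj_last (F : Based G k n c x) : ¬ G.Adj x (c (n - 1)) := by
  intro h
  have h3 := F.three_le
  refine F.not_adj_succ h ?_
  rw [Nat.sub_add_cancel (by omega), F.zero_eq]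
  exact F.adj_zero

lemma lt_of_mem (F : Based G k n c x) {i : ℕ} {u : V} (h : i ∈ succIdx G n c x u) :
    i < n - 1 ∧ G.Adj x (c i) ∧ G.Adj u (c (i + 1)) := by
  obtain ⟨⟨hi, hxi⟩, hu⟩ := mem_succIdx.1 h
  have : i ≠ n - 1 := fun h => F.not_adj_last (h ▸ hxi)
  exact ⟨by omega, hxi, hu⟩

lemma add_two_lt (F : Based G k n c x) {a : ℕ} (ha : a ∈ succIdx G n c x (c (n - 1))) :
    a + 2 < n := by
  obtain ⟨h, -, hadj⟩ := F.lt_of_mem ha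
  have : a + 1 ≠ n - 1 := by
    intro h
    rw [h] at hadj
    exact G.loopless.irrefl _ hadj
  omega

/-- The first Pósa rotation: the chord from c_{n-1} to c_{a+1} turns the path into one from c_0 to
c_{a+2}. -/
lemma not_adj_add_two (F : Based G k n c x) {a : ℕ} (ha : a ∈ succIdx G n c x (c (n - 1))) :
    ¬ G.Adj x (c (a + 2)) := by
  intro hx
  have h1 := F.add_two_lt ha
  obtain ⟨h, -, hadj⟩ := F.lt_of_mem ha
  refine F.not_run F.adj_zero hx ((F.up (i := 0) (j := a + 1) (by omega)).append hadj.symm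
    (F.down (i := a + 2) (j := n - 1) (by omega))) (by omega) ?_
  intro l hl
  simp only [Set.mem_union, Set.mem_Icc]
  omega

lemma le_card_succIdx_add_two (F : Based G k n c x) {a : ℕ}
    (ha : a ∈ succIdx G n c x (c (n - 1))) :
    G.degree x + 2 ≤ (succIdx G n c x (c (a + 2))).card + k := by
  obtain ⟨h, hxa, -⟩ := F.lt_of_mem ha
  exact F.le_card_succIdx_of_not_adj (F.mem_succSet_of_adj (by omega) hxa) (F.adj (a + 1)).symm
    (fun h => F.not_adj_add_two ha h.symm)

/-- The rotated path traverses the indices above a + 1 backwards. An attachment j there would allow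
a further rotation ending at c_j, a neighbour of `x`. -/
lemma le_of_mem_add_two (F : Based G k n c x) {a j : ℕ} (ha : a ∈ succIdx G n c x (c (n - 1)))
    (hj : j ∈ succIdx G n c x (c (a + 2))) : j ≤ a := by
  by_contra! haj
  have h1 := F.add_two_lt ha
  obtain ⟨h, hxa, hadj⟩ := F.lt_of_mem ha
  obtain ⟨hjn, hxj, hja⟩ := F.lt_of_mem hj
  have hj1 : j ≠ a + 1 := by
    rintro rfl
    exact F.not_adj_succ hxa hxj
  refine F.not_run F.adj_zero hxj (((F.up (i := 0) (j := a + 1) (by omega)).append hadj.symm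
    (F.down (i := j + 1) (j := n - 1) (by omega))).append hja.symm
    (F.up (i := a + 2) (j := j) (by omega))) (by omega) ?_
  intro l hl
  simp only [Set.mem_union, Set.mem_Icc]
  omega

/-- Attachments of the two ends in the wrong order give crossing chords, and these yield a
Hamiltonian path from c_j to c_i. -/
lemma zero_le_of_mem_add_two (F : Based G k n c x) {a i j : ℕ}
    (ha : a ∈ succIdx G n c x (c (n - 1)))
    (hi : i ∈ succIdx G n c x (c 0)) (hj : j ∈ succIdx G n c x (c (a + 2))) : i ≤ j := by
  by_contra! hji
  have h1 := F.add_two_lt ha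
  have hia := F.le_of_mem_succIdx F.not_adj_last hi ha
  obtain ⟨h, hxa, hadj⟩ := F.lt_of_mem ha
  obtain ⟨hin, hxi, hi0⟩ := F.lt_of_mem hi
  obtain ⟨hjn, hxj, hja⟩ := F.lt_of_mem hj
  refine F.not_run hxj hxi ((((F.down (i := 0) (j := j) (by omega)).append hi0
    (F.up (i := i + 1) (j := a + 1) (by omega))).append hadj.symm
    (F.down (i := a + 2) (j := n - 1) (by omega))).append hja
    (F.up (i := j + 1) (j := i) (by omega))) (by omega) ?_
  intro l hl
  simp only [Set.mem_union, Set.mem_Icc]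
  omega

section

variable {a j : ℕ} (ha : a ∈ succIdx G n c x (c (n - 1)))
  (hj : j ∈ succIdx G n c x (c (a + 2))) (hja : j < a)

include ha hj hja

lemma add_two_le (F : Based G k n c x) : j + 2 ≤ a := by
  obtain ⟨-, hxa, -⟩ := F.lt_of_mem ha
  obtain ⟨-, hxj, -⟩ := F.lt_of_mem hj
  have : a ≠ j + 1 := by
    rintro rfl
    exact F.not_adj_succ hxj hxa
  omega

/-- A second rotation, through the chord from c_{a+2} to c_{j+1}, moves the end to c_{j+2}. -/
lemma not_adj_lower (F : Based G k n c x) : ¬ G.Adj x (c (j + 2)) := by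
  intro hx
  have h1 := F.add_two_lt ha
  have h2 := F.add_two_le ha hj hja
  obtain ⟨h, hxa, hadj⟩ := F.lt_of_mem ha
  obtain ⟨hjn, hxj, haj⟩ := F.lt_of_mem hj
  refine F.not_run F.adj_zero hx (((F.up (i := 0) (j := j + 1) (by omega)).append haj.symm
    (F.up (i := a + 2) (j := n - 1) (by omega))).append hadj
    (F.down (i := j + 2) (j := a + 1) (by omega))) (by omega) ?_
  intro l hl
  simp only [Set.mem_union, Set.mem_Icc]
  omega

lemma le_card_succIdx_lower (F : Based G k n c x) :
    G.degree x + 2 ≤ (succIdx G n c x (c (j + 2))).card + k := by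
  obtain ⟨h, hxj, -⟩ := F.lt_of_mem hj
  exact F.le_card_succIdx_of_not_adj (F.mem_succSet_of_adj (by omega) hxj) (F.adj (j + 1)).symm
    (fun h => F.not_adj_lower ha hj hja h.symm)

/-- After two rotations only the indices from j + 2 to a + 1 are traversed backwards, so only
attachments in that range are excluded. -/
lemma le_or_lt_of_mem_lower (F : Based G k n c x) {m : ℕ}
    (hm : m ∈ succIdx G n c x (c (j + 2))) : m ≤ j ∨ a < m := by
  by_contra! hjm
  have h1 := F.add_two_lt ha
  have h2 := F.add_two_le ha hj hja
  have h4 := F.not_adj_lower ha hj hja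
  obtain ⟨h, hxa, hadj⟩ := F.lt_of_mem ha
  obtain ⟨hjn, hxj, haj⟩ := F.lt_of_mem hj
  obtain ⟨hmn, hxm, hmj⟩ := F.lt_of_mem hm
  have hm1 : m ≠ j + 1 := by
    rintro rfl
    exact F.not_adj_succ hxj hxm
  refine F.not_run F.adj_zero hxm ((((F.up (i := 0) (j := j + 1) (by omega)).append haj.symm
    (F.up (i := a + 2) (j := n - 1) (by omega))).append hadj
    (F.down (i := m + 1) (j := a + 1) (by omega))).append hmj.symm
    (F.up (i := j + 2) (j := m) (by omega))) (by omega) ?_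
  intro l hl
  simp only [Set.mem_union, Set.mem_Icc]
  omega

lemma zero_le_of_mem_lower (F : Based G k n c x) {i m : ℕ} (hi : i ∈ succIdx G n c x (c 0))
    (hm : m ∈ succIdx G n c x (c (j + 2))) : i ≤ m := by
  by_contra! hmi
  have h1 := F.add_two_lt ha
  have h2 := F.add_two_le ha hj hja
  have hij := F.zero_le_of_mem_add_two ha hi hj
  obtain ⟨h, hxa, hadj⟩ := F.lt_of_mem ha
  obtain ⟨hin, hxi, hi0⟩ := F.lt_of_mem hi
  obtain ⟨hjn, hxj, haj⟩ := F.lt_of_mem hj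
  obtain ⟨hmn, hxm, hmj⟩ := F.lt_of_mem hm
  refine F.not_run hxm hxi (((((F.down (i := 0) (j := m) (by omega)).append hi0
    (F.up (i := i + 1) (j := j + 1) (by omega))).append haj.symm
    (F.up (i := a + 2) (j := n - 1) (by omega))).append hadj
    (F.down (i := j + 2) (j := a + 1) (by omega))).append hmj
    (F.up (i := m + 1) (j := i) (by omega))) (by omega) ?_
  intro l hl
  simp only [Set.mem_union, Set.mem_Icc]
  omega

variable {e : ℕ} (he : e ∈ succIdx G n c x (c (j + 2))) (hae : a < e)

include he hae

omit hj hja in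
lemma add_three_le (F : Based G k n c x) : a + 3 ≤ e := by
  obtain ⟨-, hxa, -⟩ := F.lt_of_mem ha
  obtain ⟨-, hxe, -⟩ := F.lt_of_mem he
  have h1 : e ≠ a + 1 := by
    rintro rfl
    exact F.not_adj_succ hxa hxe
  have h2 : e ≠ a + 2 := by
    rintro rfl
    exact F.not_adj_add_two ha hxe
  omega

/-- The three chords at c_{a+2}, c_{j+2} and c_{n-1} would visit the arc from c_{a+3} to c_e last
and end in N(x). -/
lemma not_adj_add_three (F : Based G k n c x) : ¬ G.Adj (c (n - 1)) (c (a + 3)) := by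
  intro hv
  have h1 := F.add_three_le ha he hae
  have h2 := F.add_two_le ha hj hja
  obtain ⟨h, hxa, hadj⟩ := F.lt_of_mem ha
  obtain ⟨hjn, hxj, haj⟩ := F.lt_of_mem hj
  obtain ⟨hen, hxe, hej⟩ := F.lt_of_mem he
  refine F.not_run F.adj_zero hxe (((((F.up (i := 0) (j := j + 1) (by omega)).append haj.symm
    (F.one (a + 2))).append (F.adj (a + 1)).symm
    (F.down (i := j + 2) (j := a + 1) (by omega))).append hej
    (F.up (i := e + 1) (j := n - 1) (by omega))).append hv
    (F.up (i := a + 3) (j := e) (by omega))) (by omega) ?_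
  intro l hl
  simp only [Set.mem_union, Set.mem_Icc, Set.mem_singleton_iff]
  omega

/-- Each of the other positions, beyond e, up to j, or between j and a, gives a Hamiltonian path
between two neighbours of `x`. -/
lemma mem_add_three (F : Based G k n c x) {m : ℕ} (hm : m ∈ succIdx G n c x (c (a + 3))) :
    a < m ∧ m ≤ e := by
  have h1 := F.add_three_le ha he hae
  have h2 := F.add_two_le ha hj hja
  obtain ⟨h, hxa, hadj⟩ := F.lt_of_mem ha
  obtain ⟨hjn, hxj, haj⟩ := F.lt_of_mem hj
  obtain ⟨hen, hxe, hej⟩ := F.lt_of_mem he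
  obtain ⟨hmn, hxm, hma⟩ := F.lt_of_mem hm
  by_contra! hcon
  have hcases : e < m ∨ m ≤ j ∨ (j < m ∧ m ≤ a) := by
    by_cases ham : a < m
    · exact Or.inl (hcon ham)
    · omega
  rcases hcases with hem | hmj | ⟨hjm, hma'⟩
  · refine F.not_run hxm hxe ((((((F.down (i := e + 1) (j := m) (by omega)).append hej.symm
      (F.up (i := j + 2) (j := a + 1) (by omega))).append (F.adj (a + 1))
      (F.one (a + 2))).append haj (F.down (i := 0) (j := j + 1) (by omega))).append F.wrap.symm
      (F.down (i := m + 1) (j := n - 1) (by omega))).append hma.symm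
      (F.up (i := a + 3) (j := e) (by omega))) (by omega) ?_
    intro l hl
    simp only [Set.mem_union, Set.mem_Icc, Set.mem_singleton_iff]
    omega
  · refine F.not_run hxe hxm ((((((F.down (i := a + 3) (j := e) (by omega)).append hma
      (F.up (i := m + 1) (j := j + 1) (by omega))).append haj.symm (F.one (a + 2))).append
      (F.adj (a + 1)).symm (F.down (i := j + 2) (j := a + 1) (by omega))).append hej
      (F.up (i := e + 1) (j := n - 1) (by omega))).append F.wrap
      (F.up (i := 0) (j := m) (by omega))) (by omega) ?_
    intro l hl
    simp only [Set.mem_union, Set.mem_Icc, Set.mem_singleton_iff]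
    omega
  · refine F.not_run hxm hxj ((((F.down (i := j + 1) (j := m) (by omega)).append haj.symm
      (F.down (i := m + 1) (j := a + 2) (by omega))).append hma.symm
      (F.up (i := a + 3) (j := n - 1) (by omega))).append F.wrap
      (F.up (i := 0) (j := j) (by omega))) (by omega) ?_
    intro l hl
    simp only [Set.mem_union, Set.mem_Icc]
    omega

end

end Based

/-! ### Counting attachments, and the case of equality -/

lemma card_filter_le_rank (X : Finset ℕ) {M : ℕ} (hM : M ≤ X.card + 1) :
    (X.filter fun a => M ≤ (X.filter (· ≤ a)).card).card + M ≤ X.card + 1 := by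
  set Z := X.filter fun a => M ≤ (X.filter (· ≤ a)).card with hZ
  rcases Z.eq_empty_or_nonempty with h | h
  · rw [h]
    simpa using hM
  · have ht := Z.min'_mem h
    set t := Z.min' h with ht'
    have h1 : M ≤ (X.filter (· ≤ t)).card := (Finset.mem_filter.1 ht).2
    have h2 := card_add_card_le_of_forall_le (A := X.filter (· ≤ t)) (B := Z) (by
      intro a ha b hb
      exact (Finset.mem_filter.1 ha).2.trans (Finset.min'_le _ _ hb))
    have h3 : (X.filter (· ≤ t) ∪ Z).card ≤ X.card :=
      Finset.card_le_card (Finset.union_subset (Finset.filter_subset _ _)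
        (Finset.filter_subset _ _))
    omega

namespace Based

variable [Fintype V] [DecidableEq V] [DecidableRel G.Adj] {k n : ℕ} {c : ℕ → V} {x : V}

lemma le_card_succIdx_last (F : Based G k n c x) :
    G.degree x + 2 ≤ (succIdx G n c x (c (n - 1))).card + k := by
  obtain ⟨s, hs, hws⟩ := F.adj_last
  exact F.le_card_succIdx_of_not_adj hs hws (fun h => F.not_adj_last h.symm)

lemma le_card_succIdx_zero (F : Based G k n c x) :
    G.degree x + 1 ≤ (succIdx G n c x (c 0)).card + k := by
  have h3 := F.three_le
  exact F.le_card_succIdx (F.mem_succSet_of_adj (by omega) F.adj_zero) (F.adj 0)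

lemma exists_least (F : Based G k n c x) {a : ℕ} (ha : a ∈ succIdx G n c x (c (n - 1))) :
    ∃ j ∈ succIdx G n c x (c (a + 2)), j < a ∧ ∀ i ∈ succIdx G n c x (c (a + 2)), j ≤ i := by
  have h1 := F.le_card_succIdx_add_two ha
  have h2 := F.le_degree
  have hlt : 1 < (succIdx G n c x (c (a + 2))).card := by omega
  have hne : (succIdx G n c x (c (a + 2))).Nonempty := Finset.card_pos.1 (by omega)
  refine ⟨_, Finset.min'_mem _ hne, ?_, fun i hi => Finset.min'_le _ _ hi⟩
  obtain ⟨b, hb, hba⟩ := Finset.exists_mem_ne hlt a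
  have := F.le_of_mem_add_two ha hb
  have := Finset.min'_le _ _ hb
  omega

/-- The attachments of c_0, c_{j+2} and c_{a+2} then all lie up to a, ordered in this way since j is
least for c_{a+2}. Allowing two overlaps, they number at least 3(d + 1 - k). -/
lemma rank_le_of_forall (F : Based G k n c x) {a j : ℕ} (ha : a ∈ succIdx G n c x (c (n - 1)))
    (hj : j ∈ succIdx G n c x (c (a + 2))) (hja : j < a)
    (hmin : ∀ i ∈ succIdx G n c x (c (a + 2)), j ≤ i)
    (hno : ∀ e ∈ succIdx G n c x (c (j + 2)), e ≤ a) :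
    3 * G.degree x + 3 ≤ ((nbrIdx G n c x).filter (· ≤ a)).card + 3 * k := by
  have c1 := F.le_card_succIdx_zero
  have c2 := F.le_card_succIdx_lower ha hj hja
  have c3 := F.le_card_succIdx_add_two ha
  have hlow : ∀ m ∈ succIdx G n c x (c (j + 2)), m ≤ j := by
    intro m hm
    have := F.le_or_lt_of_mem_lower ha hj hja hm
    have := hno m hm
    omega
  have e1 := card_add_card_le_of_forall_le (A := succIdx G n c x (c 0))
    (B := succIdx G n c x (c (j + 2))) fun i hi m hm => F.zero_le_of_mem_lower ha hj hja hi hm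
  have e2 := card_add_card_le_of_forall_le
    (A := succIdx G n c x (c 0) ∪ succIdx G n c x (c (j + 2)))
    (B := succIdx G n c x (c (a + 2))) (by
      intro i hi m hm
      rcases Finset.mem_union.1 hi with hi | hi
      · exact F.zero_le_of_mem_add_two ha hi hm
      · exact (hlow i hi).trans (hmin m hm))
  have e3 : (succIdx G n c x (c 0) ∪ succIdx G n c x (c (j + 2)) ∪
      succIdx G n c x (c (a + 2))).card ≤ ((nbrIdx G n c x).filter (· ≤ a)).card := by
    refine Finset.card_le_card fun m hm => Finset.mem_filter.2 ⟨?_, ?_⟩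
    · rcases Finset.mem_union.1 hm with hm | hm
      · rcases Finset.mem_union.1 hm with hm | hm <;> exact (Finset.mem_filter.1 hm).1
      · exact (Finset.mem_filter.1 hm).1
    · rcases Finset.mem_union.1 hm with hm | hm
      · rcases Finset.mem_union.1 hm with hm | hm
        · exact F.le_of_mem_succIdx F.not_adj_last hm ha
        · exact hno m hm
      · exact F.le_of_mem_add_two ha hm
  omega

/-- Some index `a` and the least index `j` attached to `a + 2` admit an attachment of `j + 2` beyond
`a`, and the vertex of index `a + 3` has a neighbour among the successors. -/
lemma exists_attachment (F : Based G k n c x) (hbound : 7 * k ≤ 5 * G.degree x + 6) :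
    ∃ a ∈ succIdx G n c x (c (n - 1)), ∃ j ∈ succIdx G n c x (c (a + 2)), j < a ∧
      (∀ i ∈ succIdx G n c x (c (a + 2)), j ≤ i) ∧
      (∃ e ∈ succIdx G n c x (c (j + 2)), a < e) ∧
      ∃ s ∈ succSet G n c x, G.Adj (c (a + 3)) s := by
  by_contra! hno
  have hd := F.le_degree
  have hk := F.two_le
  set A := succIdx G n c x (c (n - 1)) with hA
  set M := 3 * G.degree x + 3 - 3 * k with hM
  -- These `a` have too small a rank for `rank_le_of_forall`, so c_{j+2} has an attachment beyond
  -- `a`. The assumed failure then leaves c_{a+3} without neighbours in S.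
  set A' := A.filter fun a => ¬ M ≤ ((nbrIdx G n c x).filter (· ≤ a)).card with hA'
  have key : ∀ a ∈ A', (∀ s ∈ succSet G n c x, ¬ G.Adj (c (a + 3)) s) ∧
      ¬ G.Adj (c (n - 1)) (c (a + 3)) ∧ a + 3 < n := by
    intro a ha'
    obtain ⟨ha, hrank⟩ := Finset.mem_filter.1 ha'
    obtain ⟨j, hj, hja, hmin⟩ := F.exists_least ha
    obtain ⟨e, he, hae⟩ : ∃ e ∈ succIdx G n c x (c (j + 2)), a < e := by
      by_contra! hcon
      have := F.rank_le_of_forall ha hj hja hmin hcon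
      omega
    refine ⟨hno a ha j hj hja hmin ⟨e, he, hae⟩, F.not_adj_add_three ha hj hja he hae, ?_⟩
    have := F.add_three_le ha he hae
    have := (F.lt_of_mem he).1
    omega
  have hrest : A.card ≤ A'.card +
      ((nbrIdx G n c x).filter fun a => M ≤ ((nbrIdx G n c x).filter (· ≤ a)).card).card := by
    have h1 := Finset.card_filter_add_card_filter_not (s := A)
      (fun a => M ≤ ((nbrIdx G n c x).filter (· ≤ a)).card)
    have h2 : (A.filter fun a => M ≤ ((nbrIdx G n c x).filter (· ≤ a)).card).card ≤
        ((nbrIdx G n c x).filter fun a => M ≤ ((nbrIdx G n c x).filter (· ≤ a)).card).card :=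
      Finset.card_le_card (Finset.filter_subset_filter _ (Finset.filter_subset _ _))
    rw [← hA'] at h1
    omega
  set U : Finset V := A'.image fun a => c (a + 3) with hU
  have hUcard : U.card = A'.card := by
    refine Finset.card_image_of_injOn fun a ha b hb hab => ?_
    have := F.inj _ (key a ha).2.2 _ (key b hb).2.2 hab
    omega
  have hdisj : Disjoint (succSet G n c x) U := by
    rw [Finset.disjoint_left]
    rintro s hs hsU
    obtain ⟨a, ha, rfl⟩ := Finset.mem_image.1 hsU
    obtain hx | ⟨i, hi, hxi, hia⟩ := mem_succSet.1 hs
    · exact F.ne _ hx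
    · have han := (key a ha).2.2
      have ha2 := F.not_adj_add_two (Finset.mem_filter.1 ha).1
      have := F.succ_injOn (s := {i | i < n}) (fun i hi => hi) hi (show a + 2 < n by omega) hia
      exact ha2 (this ▸ hxi)
  have hind : G.IsIndepSet ((succSet G n c x ∪ U : Finset V) : Set V) := by
    intro u hu v hv huv hadj
    rcases Finset.mem_union.1 (Finset.mem_coe.1 hu) with hu | hu <;>
      rcases Finset.mem_union.1 (Finset.mem_coe.1 hv) with hv | hv
    · exact F.succSet_indep hu hv huv hadj
    · obtain ⟨a, ha, rfl⟩ := Finset.mem_image.1 hv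
      exact (key a ha).1 u hu hadj.symm
    · obtain ⟨a, ha, rfl⟩ := Finset.mem_image.1 hu
      exact (key a ha).1 v hv hadj
    · obtain ⟨a, ha, rfl⟩ := Finset.mem_image.1 hu
      obtain ⟨b, hb, rfl⟩ := Finset.mem_image.1 hv
      exact F.not_adj_of_forall (key a ha).1 (key b hb).1 hadj
  -- The last vertex has fewer than k non-neighbours in the enlarged independent set, and all of `U`
  -- is among them.
  obtain ⟨s, hs, hws⟩ := F.adj_last
  have h1 := F.free.card_filter_not_adj_lt hind (Finset.mem_union_left _ hs) hws
  have h2 := Finset.card_filter_add_card_filter_not (s := succSet G n c x ∪ U)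
    (fun s => G.Adj (c (n - 1)) s)
  have h4 : (succSet G n c x ∪ U).filter (fun s => G.Adj (c (n - 1)) s) =
      (succSet G n c x).filter fun s => G.Adj (c (n - 1)) s := by
    rw [Finset.filter_union, Finset.union_eq_left]
    intro u hu
    obtain ⟨hu, hadj⟩ := Finset.mem_filter.1 hu
    obtain ⟨a, ha, rfl⟩ := Finset.mem_image.1 hu
    exact absurd hadj (key a ha).2.1
  rw [h4, F.card_filter_succSet, if_neg fun h => F.not_adj_last h.symm,
    Finset.card_union_of_disjoint hdisj, F.card_succSet, F.card_nbrIdx, hUcard, ← hA] at h2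
  -- At most d + 1 - `M` elements of X have rank at least `M`, so the count forces `M` < k, that is
  -- 3d + 3 < 4k, against 5d ≥ 7k - 6. For larger `M` no rank reaches it, and all of `A` lies in
  -- `A'`.
  by_cases hMd : M ≤ G.degree x + 1
  · have h5 := card_filter_le_rank (nbrIdx G n c x) (M := M) (by rw [F.card_nbrIdx]; exact hMd)
    rw [F.card_nbrIdx] at h5
    omega
  · have h6 : A' = A := by
      refine Finset.filter_true_of_mem fun a ha => ?_
      have := Finset.card_filter_le (nbrIdx G n c x) (· ≤ a)
      rw [F.card_nbrIdx] at this
      omega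
    rw [h6] at h2
    omega

/-- The parameters and the neighbours of `x` in a based configuration. -/
lemma exists_structure (F : Based G k n c x) (hbound : 7 * k ≤ 5 * G.degree x + 6) :
    k = 3 ∧ ∃ a, 0 < a ∧ a + 3 < n - 1 ∧ nbrIdx G n c x = {0, a, a + 3} ∧
      (∃ s ∈ succSet G n c x, G.Adj (c (a + 2)) s) ∧
      succIdx G n c x (c 0) = {0} ∧ succIdx G n c x (c (n - 1)) = {a, a + 3} ∧
      succIdx G n c x (c (a + 2)) = {0, a} ∧ succIdx G n c x (c 2) = {0, a + 3} := by
  obtain ⟨a, ha, j, hj, hja, hmin, ⟨e, he, hae⟩, s, hs, has⟩ := F.exists_attachment hbound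
  have h3 := F.three_le
  have hd := F.le_degree
  have hk := F.two_le
  have c1 := F.le_card_succIdx_zero
  have c2 := F.le_card_succIdx_lower ha hj hja
  have c3 := F.le_card_succIdx_add_two ha
  have c4 := F.le_card_succIdx hs has
  have c5 := F.le_card_succIdx_last
  set X := nbrIdx G n c x with hX
  set A := succIdx G n c x (c (n - 1)) with hA
  set B := succIdx G n c x (c 0) with hB
  set D := succIdx G n c x (c (a + 2)) with hD
  set L := succIdx G n c x (c (j + 2)) with hL
  set E := succIdx G n c x (c (a + 3)) with hE
  have hsub : ∀ u, succIdx G n c x u ⊆ X := fun u => Finset.filter_subset _ _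
  have hXcard : X.card = G.degree x := F.card_nbrIdx
  have hEm : ∀ m ∈ E, ∀ e ∈ L, a < e → a < m ∧ m ≤ e := fun m hm e he hae =>
    F.mem_add_three ha hj hja he hae hm
  have hsplit := Finset.card_filter_add_card_filter_not (s := L) (fun m => m ≤ a)
  have hLlow : ∀ m ∈ L.filter (· ≤ a), m ≤ j := by
    intro m hm
    obtain ⟨hm, hma⟩ := Finset.mem_filter.1 hm
    have := F.le_or_lt_of_mem_lower ha hj hja hm
    omega
  have e1 := card_add_card_le_of_forall_le (A := B) (B := L.filter (· ≤ a))
    fun i hi m hm => F.zero_le_of_mem_lower ha hj hja hi (Finset.mem_filter.1 hm).1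
  have e2 := card_add_card_le_of_forall_le (A := B ∪ L.filter (· ≤ a)) (B := D) (by
    intro i hi m hm
    rcases Finset.mem_union.1 hi with hi | hi
    · exact F.zero_le_of_mem_add_two ha hi hm
    · exact (hLlow i hi).trans (hmin m hm))
  have e3 := card_add_card_le_of_forall_le (A := E) (B := L.filter (fun m => ¬ m ≤ a)) (by
    intro i hi m hm
    obtain ⟨hm, hma⟩ := Finset.mem_filter.1 hm
    exact (hEm i hi m hm (by omega)).2)
  have hdisj : Disjoint (B ∪ L.filter (· ≤ a) ∪ D) (E ∪ L.filter (fun m => ¬ m ≤ a)) := by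
    rw [Finset.disjoint_left]
    intro i hi hi'
    have h1 : i ≤ a := by
      rcases Finset.mem_union.1 hi with hi | hi
      · rcases Finset.mem_union.1 hi with hi | hi
        · exact F.le_of_mem_succIdx F.not_adj_last hi ha
        · exact (Finset.mem_filter.1 hi).2
      · exact F.le_of_mem_add_two ha hi
    rcases Finset.mem_union.1 hi' with hi' | hi'
    · have := (hEm i hi' e he hae).1
      omega
    · exact (Finset.mem_filter.1 hi').2 h1
  have e4 : ((B ∪ L.filter (· ≤ a) ∪ D) ∪ (E ∪ L.filter (fun m => ¬ m ≤ a))).card ≤ X.card := by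
    refine Finset.card_le_card ?_
    refine Finset.union_subset (Finset.union_subset (Finset.union_subset (hsub _)
      ((Finset.filter_subset _ _).trans (hsub _))) (hsub _)) (Finset.union_subset (hsub _)
      ((Finset.filter_subset _ _).trans (hsub _)))
  rw [Finset.card_union_of_disjoint hdisj] at e4
  -- The four attachment sets have total size at least 4d + 6 - 4k, and with three overlaps at most
  -- d + 3. Hence 3d + 3 ≤ 4k, which with 5d ≥ 7k - 6 gives k ≤ 3; d ≥ k excludes k = 2.
  have hk3 : k = 3 := by omega
  have hd3 : G.degree x = 3 := by omega
  obtain ⟨m, hm⟩ : E.Nonempty := Finset.card_pos.1 (by omega)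
  have hm' := hEm m hm e he hae
  have hX3 : X = {j, a, m} := by
    symm
    refine Finset.eq_of_subset_of_card_le ?_ ?_
    · intro i hi
      simp only [Finset.mem_insert, Finset.mem_singleton] at hi
      rcases hi with rfl | rfl | rfl
      · exact hsub _ hj
      · exact hsub _ ha
      · exact hsub _ hm
    · rw [hXcard, hd3, Finset.card_eq_three.2 ⟨j, a, m, by omega, by omega, by omega, rfl⟩]
  have hcases : ∀ i ∈ X, i = j ∨ i = a ∨ i = m := by
    intro i hi
    rw [hX3] at hi
    simpa using hi
  have h0X : 0 ∈ X := mem_nbrIdx.2 ⟨by omega, F.adj_zero⟩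
  have hj0 : j = 0 := by
    have := hcases 0 h0X
    omega
  subst hj0
  have hem : e = m := by
    have := hcases e (hsub _ he)
    omega
  subst hem
  have hEe : E = {e} := by
    refine Finset.eq_singleton_iff_unique_mem.2 ⟨hm, fun i hi => ?_⟩
    have := hcases i (hsub _ hi)
    have := (hEm i hi e he hae).1
    omega
  -- A vertex outside N(x) would have at least d + 2 - k = 2 attachments, but c_{a+3} has only one.
  have hxa3 : G.Adj x (c (a + 3)) := by
    by_contra hcon
    have := F.le_card_succIdx_of_not_adj hs has (fun h => hcon h.symm)
    rw [← hE, hEe] at this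
    simp at this
    omega
  have hen := (F.lt_of_mem he).1
  have hae3 := F.add_three_le ha he hae
  have hea : e = a + 3 := by
    have := hcases (a + 3) (mem_nbrIdx.2 ⟨by omega, hxa3⟩)
    omega
  subst hea
  have hDs : D = {0, a} := by
    refine Finset.eq_of_subset_of_card_le ?_ ?_
    · intro i hi
      have := hcases i (hsub _ hi)
      have := F.le_of_mem_add_two ha hi
      simp only [Finset.mem_insert, Finset.mem_singleton]
      omega
    · have : ({0, a} : Finset ℕ).card ≤ 2 := Finset.card_le_two
      omega
  have hLs : L = {0, a + 3} := by
    refine Finset.eq_of_subset_of_card_le ?_ ?_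
    · intro i hi
      have := hcases i (hsub _ hi)
      have := F.le_or_lt_of_mem_lower ha hj hja hi
      simp only [Finset.mem_insert, Finset.mem_singleton]
      omega
    · have : ({0, a + 3} : Finset ℕ).card ≤ 2 := Finset.card_le_two
      omega
  have hBs : B = {0} := by
    refine Finset.eq_singleton_iff_unique_mem.2 ⟨?_, fun i hi => ?_⟩
    · exact mem_succIdx.2 ⟨⟨by omega, F.adj_zero⟩, F.adj 0⟩
    · have := F.zero_le_of_mem_add_two ha hi hj
      omega
  have hAs : A = {a, a + 3} := by
    refine Finset.eq_of_subset_of_card_le ?_ ?_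
    · intro i hi
      have h1 := hcases i (hsub _ hi)
      have h2 : i ≠ 0 := by
        rintro rfl
        have := F.le_of_mem_add_two hi he
        omega
      simp only [Finset.mem_insert, Finset.mem_singleton]
      omega
    · have : ({a, a + 3} : Finset ℕ).card ≤ 2 := Finset.card_le_two
      omega
  refine ⟨hk3, a, hja, hen, hX3, ?_, hBs, hAs, hDs, hLs⟩
  obtain ⟨han, hxa, -⟩ := F.lt_of_mem ha
  exact ⟨c (a + 1), F.mem_succSet_of_adj (by omega) hxa, (F.adj (a + 1)).symm⟩

lemma rotate_structure (F : Based G k n c x) {a : ℕ} (han : a + 3 < n)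
    (hxa : G.Adj x (c (a + 3))) (hs : ∃ s ∈ succSet G n c x, G.Adj (c (a + 2)) s) :
    Based G k n (fun i => c (i + (a + 3))) x where
  toConfig := F.toConfig.rotate (a + 3)
  adj_zero := by simpa using hxa
  adj_last := by
    rw [F.succSet_rotate]
    have : n - 1 + (a + 3) = a + 2 + n := by omega
    rwa [this, F.periodic]

/-- The index `a` of `exists_structure` is always three. -/
lemma structure_eq_three (F : Based G k n c x) (hbound : 7 * k ≤ 5 * G.degree x + 6) :
    k = 3 ∧ n = 9 ∧ nbrIdx G n c x = {0, 3, 6} ∧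
      succIdx G n c x (c 0) = {0} ∧ succIdx G n c x (c 8) = {3, 6} ∧
      succIdx G n c x (c 5) = {0, 3} ∧ succIdx G n c x (c 2) = {0, 6} := by
  -- Restarting at the third neighbour gives another based configuration. Its two nonzero indices n
  -- - a - 3 and n - 3 must again differ by 3, so a = 3.
  have key : ∀ c, Based G k n c x → ∀ a, 0 < a → a + 3 < n - 1 → nbrIdx G n c x = {0, a, a + 3} →
      (∃ s ∈ succSet G n c x, G.Adj (c (a + 2)) s) → a = 3 ∧
      Based G k n (fun i => c (i + (a + 3))) x ∧
      nbrIdx G n (fun i => c (i + (a + 3))) x = {0, n - 6, n - 3} := by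
    intro c F a ha han hX hs
    have hmem : ∀ i, i = 0 ∨ i = a ∨ i = a + 3 → G.Adj x (c i) := by
      intro i hi
      have : i ∈ nbrIdx G n c x := by
        rw [hX]
        simpa using hi
      exact (mem_nbrIdx.1 this).2
    have F' := F.rotate_structure (by omega) (hmem _ (by simp)) hs
    obtain ⟨-, b, hb, hbn, hXb, -⟩ := F'.exists_structure hbound
    have h1 : n - (a + 3) ∈ nbrIdx G n (fun i => c (i + (a + 3))) x := by
      refine mem_nbrIdx.2 ⟨by omega, ?_⟩
      have : n - (a + 3) + (a + 3) = 0 + n := by omega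
      rw [this, F.periodic]
      exact hmem 0 (by simp)
    have h2 : n - 3 ∈ nbrIdx G n (fun i => c (i + (a + 3))) x := by
      refine mem_nbrIdx.2 ⟨by omega, ?_⟩
      have : n - 3 + (a + 3) = a + n := by omega
      rw [this, F.periodic]
      exact hmem a (by simp)
    have h1' := h1
    have h2' := h2
    rw [hXb] at h1' h2'
    simp only [Finset.mem_insert, Finset.mem_singleton] at h1' h2'
    have ha3 : a = 3 := by omega
    refine ⟨ha3, F', ?_⟩
    rw [hXb]
    congr 2
    · omega
    · congr 1
      omega
  obtain ⟨hk, a, ha, han, hX, hs, hB, hA, hD, hL⟩ := F.exists_structure hbound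
  obtain ⟨rfl, F', hX'⟩ := key c F a ha han hX hs
  obtain ⟨-, b, hb, hbn, hXb, hsb, -⟩ := F'.exists_structure hbound
  obtain ⟨rfl, -⟩ := key _ F' b hb hbn hXb hsb
  -- The restarted configuration also has its middle index equal to 3, which fixes the remaining gap
  -- n - 6.
  have hn : n = 9 := by
    have h6 : (6 : ℕ) ∈ ({0, n - 6, n - 3} : Finset ℕ) := by
      rw [← hX', hXb]
      simp
    simp only [Finset.mem_insert, Finset.mem_singleton] at h6
    have h3 : (3 : ℕ) ∈ ({0, n - 6, n - 3} : Finset ℕ) := by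
      rw [← hX', hXb]
      simp
    simp only [Finset.mem_insert, Finset.mem_singleton] at h3
    omega
  subst hn
  exact ⟨hk, rfl, hX, hB, hA, hD, hL⟩

end Based

/-! ### Recognising the Petersen graph -/

/-- Allows a forbidden chord to be refuted by listing the nine indices of a Hamiltonian path between
neighbours of `x`. The default `rfl` arguments read off its two ends. -/
lemma Frame.not_path {c : ℕ → V} {x : V} (F : Frame G 9 c x) (l : List ℕ)
    (hlen : l.length = 9) (hl : ∀ i < 9, i ∈ l) {a b : ℕ}
    (ha : G.Adj x (c a)) (hb : G.Adj x (c b))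
    (hchain : l.IsChain fun i j => G.Adj (c i) (c j)) (ha' : l.head? = some a := by rfl)
    (hb' : l.getLast? = some b := by rfl) : False := by
  have key : ∀ (l : List ℕ) (a b : ℕ), l.head? = some a → l.getLast? = some b →
      l.IsChain (fun i j => G.Adj (c i) (c j)) → Run G c a b l.length {i | i ∈ l} := by
    intro l
    induction l with
    | nil => simp
    | cons y l ih =>
      intro a b ha hb h
      obtain rfl : y = a := by simpa using ha
      cases l with
      | nil =>
        obtain rfl : y = b := by simpa using hb
        obtain ⟨p, hp, hs⟩ := F.one y
        exact ⟨p, hp, by simp⟩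
      | cons z l =>
        obtain ⟨p, hp, hs⟩ := (F.one y).append h.rel (ih z b rfl (by simpa using hb) h.of_cons)
        refine ⟨p, by rw [hp]; simp; omega, fun i hi => hs i ?_⟩
        rcases List.mem_cons.1 hi with rfl | hi
        · exact Or.inl rfl
        · exact Or.inr hi
  exact F.not_run ha hb (key l a b ha' hb' hchain) hlen hl

/-- A numbering of the vertices of the Petersen graph along a nine-cycle, followed by the remaining
vertex. -/
def petersenVertex : Fin 10 → {s : Finset (Fin 5) // s.card = 2} :=
  ![⟨{2, 3}, rfl⟩, ⟨{0, 4}, rfl⟩, ⟨{1, 3}, rfl⟩, ⟨{2, 4}, rfl⟩, ⟨{0, 3}, rfl⟩, ⟨{1, 2}, rfl⟩,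
    ⟨{3, 4}, rfl⟩, ⟨{0, 2}, rfl⟩, ⟨{1, 4}, rfl⟩, ⟨{0, 1}, rfl⟩]

lemma petersenVertex_bijective : Function.Bijective petersenVertex := by
  refine (Fintype.bijective_iff_injective_and_card _).2 ⟨by decide, ?_⟩
  decide

/-- The edges of the Petersen graph in the numbering `petersenVertex`. -/
def petersenEdges : List (ℕ × ℕ) :=
  [(0, 1), (1, 2), (2, 3), (3, 4), (4, 5), (5, 6), (6, 7), (7, 8), (0, 8), (4, 8), (2, 7),
    (1, 5), (0, 9), (3, 9), (6, 9)]

/-- The pairs of distinct non-adjacent vertices in the numbering `petersenVertex`. -/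
def petersenNonEdges : List (ℕ × ℕ) :=
  [(0, 2), (0, 3), (0, 4), (0, 5), (0, 6), (0, 7), (1, 3), (1, 4), (1, 6), (1, 7), (1, 8),
    (1, 9), (2, 4), (2, 5), (2, 6), (2, 8), (2, 9), (3, 5), (3, 6), (3, 7), (3, 8), (4, 6),
    (4, 7), (4, 9), (5, 7), (5, 8), (5, 9), (6, 8), (7, 9), (8, 9)]

lemma petersenEdges_spec (i j : Fin 10) (hij : i < j) :
    ((i.1, j.1) ∈ petersenEdges ∧ Disjoint (petersenVertex i).1 (petersenVertex j).1) ∨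
    ((i.1, j.1) ∈ petersenNonEdges ∧ ¬ Disjoint (petersenVertex i).1 (petersenVertex j).1) := by
  revert i j
  decide

lemma nonempty_iso_petersenGraph (f : ℕ → V) (hinj : ∀ i < 10, ∀ j < 10, f i = f j → i = j)
    (hsurj : ∀ v, ∃ i < 10, f i = v) (hpos : ∀ p ∈ petersenEdges, G.Adj (f p.1) (f p.2))
    (hneg : ∀ p ∈ petersenNonEdges, ¬ G.Adj (f p.1) (f p.2)) :
    Nonempty (G ≃g petersenGraph) := by
  have hf : Function.Bijective fun i : Fin 10 => f i := by
    refine ⟨fun i j h => Fin.ext (hinj _ i.2 _ j.2 h), fun v => ?_⟩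
    obtain ⟨i, hi, hv⟩ := hsurj v
    exact ⟨⟨i, hi⟩, hv⟩
  have hlt : ∀ i j : Fin 10, i < j →
      (petersenGraph.Adj (petersenVertex i) (petersenVertex j) ↔ G.Adj (f i) (f j)) := by
    intro i j hij
    rcases petersenEdges_spec i j hij with ⟨h1, h2⟩ | ⟨h1, h2⟩
    · exact iff_of_true h2 (hpos _ h1)
    · exact iff_of_false h2 (hneg _ h1)
  have hall : ∀ i j : Fin 10,
      petersenGraph.Adj (petersenVertex i) (petersenVertex j) ↔ G.Adj (f i) (f j) := by
    intro i j
    rcases lt_trichotomy i j with h | rfl | h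
    · exact hlt i j h
    · simp
    · rw [petersenGraph.adj_comm, G.adj_comm]
      exact hlt j i h
  let e := (Equiv.ofBijective _ hf).symm.trans (Equiv.ofBijective _ petersenVertex_bijective)
  refine ⟨⟨e, ?_⟩⟩
  intro u v
  obtain ⟨i, rfl⟩ := hf.surjective u
  obtain ⟨j, rfl⟩ := hf.surjective v
  have he : ∀ i : Fin 10, e (f i) = petersenVertex i := by
    intro i
    simp only [e, Equiv.trans_apply, Equiv.ofBijective_apply]
    congr 1
    exact (Equiv.ofBijective _ hf).symm_apply_apply i
  rw [he, he]
  exact hall i j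

namespace Based

variable [Fintype V] [DecidableEq V] [DecidableRel G.Adj] {k n : ℕ} {c : ℕ → V} {x : V}

/-- A based configuration lives in the Petersen graph. -/
lemma nonempty_iso (F : Based G k n c x) (hbound : 7 * k ≤ 5 * G.degree x + 6) :
    Nonempty (G ≃g petersenGraph) := by
  obtain ⟨rfl, rfl, hX, hB, hA, hD, hL⟩ := F.structure_eq_three hbound
  have hxiff : ∀ i < 9, (G.Adj x (c i) ↔ i ∈ ({0, 3, 6} : Finset ℕ)) := by
    intro i hi
    rw [← hX, mem_nbrIdx]
    exact ⟨fun h => ⟨hi, h⟩, fun h => h.2⟩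
  have hx : ∀ i, i ∈ ({0, 3, 6} : Finset ℕ) → G.Adj x (c i) := by
    intro i hi
    rw [← hX] at hi
    exact (mem_nbrIdx.1 hi).2
  have hxn : ∀ i < 9, i ∉ ({0, 3, 6} : Finset ℕ) → ¬ G.Adj x (c i) := by
    intro i hi hi' h
    exact hi' ((hxiff i hi).1 h)
  have hin : ∀ {u : V} {s : Finset ℕ}, succIdx G 9 c x u = s → ∀ i, i ∈ s →
      G.Adj u (c (i + 1)) := by
    intro u s hs i hi
    rw [← hs] at hi
    exact (mem_succIdx.1 hi).2
  have hout : ∀ {u : V} {s : Finset ℕ}, succIdx G 9 c x u = s → ∀ i, i ∉ s →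
      i ∈ ({0, 3, 6} : Finset ℕ) → ¬ G.Adj u (c (i + 1)) := by
    intro u s hs i hi hi' h
    rw [← hX] at hi'
    rw [← hs] at hi
    exact hi (mem_succIdx.2 ⟨mem_nbrIdx.1 hi', h⟩)
  have h84 : G.Adj (c 8) (c 4) := hin hA 3 (by simp)
  have h27 : G.Adj (c 2) (c 7) := hin hL 6 (by simp)
  have h51 : G.Adj (c 5) (c 1) := hin hD 0 (by simp)
  have h80 : G.Adj (c 8) (c 0) := F.wrap
  have hn0 := hout hB
  have hn8 := hout hA
  have hn5 := hout hD
  have hn2 := hout hL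
  set f : ℕ → V := fun i => if i = 9 then x else c i with hf
  -- Some pairs are settled by the known attachment sets, by N(x), or by the independence of the
  -- successors. For each of the others, the extra chord gives a Hamiltonian path of the cycle
  -- joining two of c_0, c_3, c_6.
  have hneg : ∀ p ∈ petersenNonEdges, ¬ G.Adj (f p.1) (f p.2) := by
    unfold petersenNonEdges
    simp only [List.forall_mem_cons, List.not_mem_nil, false_imp_iff, implies_true, and_true]
    refine ⟨?_, ?_, ?_, ?_, ?_, ?_, ?_, ?_, ?_, ?_, ?_, ?_, ?_, ?_, ?_, ?_, ?_, ?_, ?_, ?_, ?_, ?_, ?_, ?_, ?_, ?_, ?_, ?_, ?_, ?_⟩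
    · exact fun h => F.not_path [0, 2, 1, 5, 6, 7, 8, 4, 3] rfl (by decide) (hx 0 (by simp)) (hx 3 (by simp))
        (.cons_cons h <| .cons_cons (F.adj 1).symm <| .cons_cons h51.symm <| .cons_cons (F.adj 5) <| .cons_cons (F.adj 6) <| .cons_cons (F.adj 7) <| .cons_cons h84 <| .cons_cons (F.adj 3).symm <| .singleton _)
    · exact fun h => F.not_path [0, 3, 2, 1, 5, 4, 8, 7, 6] rfl (by decide) (hx 0 (by simp)) (hx 6 (by simp))
        (.cons_cons h <| .cons_cons (F.adj 2).symm <| .cons_cons (F.adj 1).symm <| .cons_cons h51.symm <| .cons_cons (F.adj 4).symm <| .cons_cons h84.symm <| .cons_cons (F.adj 7).symm <| .cons_cons (F.adj 6).symm <| .singleton _)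
    · exact hn0 3 (by decide) (by simp)
    · exact fun h => F.not_path [0, 5, 1, 2, 3, 4, 8, 7, 6] rfl (by decide) (hx 0 (by simp)) (hx 6 (by simp))
        (.cons_cons h <| .cons_cons h51 <| .cons_cons (F.adj 1) <| .cons_cons (F.adj 2) <| .cons_cons (F.adj 3) <| .cons_cons h84.symm <| .cons_cons (F.adj 7).symm <| .cons_cons (F.adj 6).symm <| .singleton _)
    · exact fun h => F.not_path [0, 6, 5, 1, 2, 7, 8, 4, 3] rfl (by decide) (hx 0 (by simp)) (hx 3 (by simp))
        (.cons_cons h <| .cons_cons (F.adj 5).symm <| .cons_cons h51 <| .cons_cons (F.adj 1) <| .cons_cons h27 <| .cons_cons (F.adj 7) <| .cons_cons h84 <| .cons_cons (F.adj 3).symm <| .singleton _)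
    · exact hn0 6 (by decide) (by simp)
    · exact fun h => F.not_path [0, 1, 3, 2, 7, 8, 4, 5, 6] rfl (by decide) (hx 0 (by simp)) (hx 6 (by simp))
        (.cons_cons (F.adj 0) <| .cons_cons h <| .cons_cons (F.adj 2).symm <| .cons_cons h27 <| .cons_cons (F.adj 7) <| .cons_cons h84 <| .cons_cons (F.adj 4) <| .cons_cons (F.adj 5) <| .singleton _)
    · exact F.not_adj_succ_succ (i := 0) (j := 3) (by decide) (by decide) (hx _ (by simp)) (hx _ (by simp))
    · exact fun h => F.not_path [0, 1, 6, 5, 4, 8, 7, 2, 3] rfl (by decide) (hx 0 (by simp)) (hx 3 (by simp))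
        (.cons_cons (F.adj 0) <| .cons_cons h <| .cons_cons (F.adj 5).symm <| .cons_cons (F.adj 4).symm <| .cons_cons h84.symm <| .cons_cons (F.adj 7).symm <| .cons_cons h27.symm <| .cons_cons (F.adj 2) <| .singleton _)
    · exact F.not_adj_succ_succ (i := 0) (j := 6) (by decide) (by decide) (hx _ (by simp)) (hx _ (by simp))
    · exact fun h => hn8 0 (by decide) (by simp) h.symm
    · exact fun h => hxn 1 (by decide) (by decide) h.symm
    · exact hn2 3 (by decide) (by simp)
    · exact fun h => F.not_path [0, 1, 2, 5, 6, 7, 8, 4, 3] rfl (by decide) (hx 0 (by simp)) (hx 3 (by simp))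
        (.cons_cons (F.adj 0) <| .cons_cons (F.adj 1) <| .cons_cons h <| .cons_cons (F.adj 5) <| .cons_cons (F.adj 6) <| .cons_cons (F.adj 7) <| .cons_cons h84 <| .cons_cons (F.adj 3).symm <| .singleton _)
    · exact fun h => F.not_path [0, 1, 5, 4, 8, 7, 6, 2, 3] rfl (by decide) (hx 0 (by simp)) (hx 3 (by simp))
        (.cons_cons (F.adj 0) <| .cons_cons h51.symm <| .cons_cons (F.adj 4).symm <| .cons_cons h84.symm <| .cons_cons (F.adj 7).symm <| .cons_cons (F.adj 6).symm <| .cons_cons h.symm <| .cons_cons (F.adj 2) <| .singleton _)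
    · exact fun h => F.not_path [0, 1, 2, 8, 7, 6, 5, 4, 3] rfl (by decide) (hx 0 (by simp)) (hx 3 (by simp))
        (.cons_cons (F.adj 0) <| .cons_cons (F.adj 1) <| .cons_cons h <| .cons_cons (F.adj 7).symm <| .cons_cons (F.adj 6).symm <| .cons_cons (F.adj 5).symm <| .cons_cons (F.adj 4).symm <| .cons_cons (F.adj 3).symm <| .singleton _)
    · exact fun h => hxn 2 (by decide) (by decide) h.symm
    · exact fun h => F.not_path [0, 1, 2, 3, 5, 4, 8, 7, 6] rfl (by decide) (hx 0 (by simp)) (hx 6 (by simp))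
        (.cons_cons (F.adj 0) <| .cons_cons (F.adj 1) <| .cons_cons (F.adj 2) <| .cons_cons h <| .cons_cons (F.adj 4).symm <| .cons_cons h84.symm <| .cons_cons (F.adj 7).symm <| .cons_cons (F.adj 6).symm <| .singleton _)
    · exact fun h => F.not_path [0, 1, 2, 7, 8, 4, 5, 6, 3] rfl (by decide) (hx 0 (by simp)) (hx 3 (by simp))
        (.cons_cons (F.adj 0) <| .cons_cons (F.adj 1) <| .cons_cons h27 <| .cons_cons (F.adj 7) <| .cons_cons h84 <| .cons_cons (F.adj 4) <| .cons_cons (F.adj 5) <| .cons_cons h.symm <| .singleton _)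
    · exact fun h => F.not_path [0, 1, 2, 3, 7, 8, 4, 5, 6] rfl (by decide) (hx 0 (by simp)) (hx 6 (by simp))
        (.cons_cons (F.adj 0) <| .cons_cons (F.adj 1) <| .cons_cons (F.adj 2) <| .cons_cons h <| .cons_cons (F.adj 7) <| .cons_cons h84 <| .cons_cons (F.adj 4) <| .cons_cons (F.adj 5) <| .singleton _)
    · exact fun h => F.not_path [0, 1, 2, 7, 6, 5, 4, 8, 3] rfl (by decide) (hx 0 (by simp)) (hx 3 (by simp))
        (.cons_cons (F.adj 0) <| .cons_cons (F.adj 1) <| .cons_cons h27 <| .cons_cons (F.adj 6).symm <| .cons_cons (F.adj 5).symm <| .cons_cons (F.adj 4).symm <| .cons_cons h84.symm <| .cons_cons h.symm <| .singleton _)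
    · exact fun h => F.not_path [0, 1, 5, 6, 4, 8, 7, 2, 3] rfl (by decide) (hx 0 (by simp)) (hx 3 (by simp))
        (.cons_cons (F.adj 0) <| .cons_cons h51.symm <| .cons_cons (F.adj 5) <| .cons_cons h.symm <| .cons_cons h84.symm <| .cons_cons (F.adj 7).symm <| .cons_cons h27.symm <| .cons_cons (F.adj 2) <| .singleton _)
    · exact F.not_adj_succ_succ (i := 3) (j := 6) (by decide) (by decide) (hx _ (by simp)) (hx _ (by simp))
    · exact fun h => hxn 4 (by decide) (by decide) h.symm
    · exact hn5 6 (by decide) (by simp)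
    · exact fun h => F.not_path [0, 1, 2, 3, 4, 5, 8, 7, 6] rfl (by decide) (hx 0 (by simp)) (hx 6 (by simp))
        (.cons_cons (F.adj 0) <| .cons_cons (F.adj 1) <| .cons_cons (F.adj 2) <| .cons_cons (F.adj 3) <| .cons_cons (F.adj 4) <| .cons_cons h <| .cons_cons (F.adj 7).symm <| .cons_cons (F.adj 6).symm <| .singleton _)
    · exact fun h => hxn 5 (by decide) (by decide) h.symm
    · exact fun h => F.not_path [0, 1, 2, 7, 8, 6, 5, 4, 3] rfl (by decide) (hx 0 (by simp)) (hx 3 (by simp))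
        (.cons_cons (F.adj 0) <| .cons_cons (F.adj 1) <| .cons_cons h27 <| .cons_cons (F.adj 7) <| .cons_cons h.symm <| .cons_cons (F.adj 5).symm <| .cons_cons (F.adj 4).symm <| .cons_cons (F.adj 3).symm <| .singleton _)
    · exact fun h => hxn 7 (by decide) (by decide) h.symm
    · exact fun h => hxn 8 (by decide) (by decide) h.symm
  have hpos : ∀ p ∈ petersenEdges, G.Adj (f p.1) (f p.2) := by
    unfold petersenEdges
    simp only [List.forall_mem_cons, List.not_mem_nil, false_imp_iff, implies_true, and_true]
    refine ⟨?_, ?_, ?_, ?_, ?_, ?_, ?_, ?_, ?_, ?_, ?_, ?_, ?_, ?_, ?_⟩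
    · exact F.adj 0
    · exact F.adj 1
    · exact F.adj 2
    · exact F.adj 3
    · exact F.adj 4
    · exact F.adj 5
    · exact F.adj 6
    · exact F.adj 7
    · exact h80.symm
    · exact h84.symm
    · exact h27
    · exact h51.symm
    · exact (hx 0 (by simp)).symm
    · exact (hx 3 (by simp)).symm
    · exact (hx 6 (by simp)).symm
  have hfc : ∀ i < 9, f i = c i := fun i hi => if_neg (by omega)
  refine nonempty_iso_petersenGraph f ?_ ?_ hpos hneg
  · intro i hi j hj hij
    by_cases h9 : i = 9 <;> by_cases h9' : j = 9
    · omega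
    · rw [h9, hfc j (by omega)] at hij
      exact absurd hij.symm (F.ne j)
    · rw [h9', hfc i (by omega)] at hij
      exact absurd hij (F.ne i)
    · rw [hfc i (by omega), hfc j (by omega)] at hij
      exact F.inj i (by omega) j (by omega) hij
  · intro y
    by_cases hyx : y = x
    · exact ⟨9, by omega, hyx.symm⟩
    by_cases hy : ∃ i, c i = y
    · obtain ⟨i, rfl⟩ := hy
      obtain ⟨j, hj, hji⟩ := F.exists_lt_eq i
      exact ⟨j, by omega, (hfc j hj).trans hji⟩
    · exfalso
      push Not at hy
      have hyS : ∀ i, i ∈ ({0, 3, 6} : Finset ℕ) → ¬ G.Adj y (c (i + 1)) := by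
        intro i hi h
        rw [← hX] at hi
        obtain ⟨hi9, hxi⟩ := mem_nbrIdx.1 hi
        obtain ⟨j, -, hj⟩ := F.exists_idx_of_adj_succSet F.not_adj_last
          (F.mem_succSet_of_adj hi9 hxi) h
        exact hy j hj
      have hSS : ∀ i j, i ∈ ({0, 3, 6} : Finset ℕ) → j ∈ ({0, 3, 6} : Finset ℕ) →
          ¬ G.Adj (c (i + 1)) (c (j + 1)) := by
        intro i j hi hj
        rw [← hX] at hi hj
        obtain ⟨hi9, hxi⟩ := mem_nbrIdx.1 hi
        obtain ⟨hj9, hxj⟩ := mem_nbrIdx.1 hj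
        exact F.not_adj_succ_succ hi9 hj9 hxi hxj
      -- Otherwise the edge c_i c_{i+1} and the three vertices c_{j+1}, c_{l+1}, `y` induce P₂ ∪
      -- 3P₁.
      have hadj : ∀ i j l, i ∈ ({0, 3, 6} : Finset ℕ) → j ∈ ({0, 3, 6} : Finset ℕ) →
          l ∈ ({0, 3, 6} : Finset ℕ) → i ≠ j → i ≠ l → j ≠ l → ¬ G.Adj (c i) (c (j + 1)) →
          ¬ G.Adj (c i) (c (l + 1)) → G.Adj y (c i) := by
        intro i j l hi hj hl hij hil hjl h1 h2
        by_contra hyi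
        have hlt9 : ∀ i ∈ ({0, 3, 6} : Finset ℕ), i + 1 < 9 := by decide
        have hinj : ∀ i ∈ ({0, 3, 6} : Finset ℕ), ∀ j ∈ ({0, 3, 6} : Finset ℕ),
            c (i + 1) = c (j + 1) → i = j := by
          intro i hi j hj h
          have := F.inj _ (hlt9 i hi) _ (hlt9 j hj) h
          omega
        have hcard : ({c (j + 1), c (l + 1), y} : Finset V).card = 3 :=
          Finset.card_eq_three.2 ⟨_, _, _, fun h => hjl (hinj j hj l hl h), hy _, hy _, rfl⟩
        have hi1 := hSS i j hi hj
        have hi2 := hSS i l hi hl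
        have hjl1 := hSS j l hj hl
        have := F.free.card_lt (F.adj i) {c (j + 1), c (l + 1), y} ?_ ?_ ?_ ?_ ?_
        · omega
        · have hyj := hyS j hj
          have hyl := hyS l hl
          intro u hu v hv huv hadj
          simp only [Finset.coe_insert, Finset.coe_singleton, Set.mem_insert_iff,
            Set.mem_singleton_iff] at hu hv
          rcases hu with rfl | rfl | rfl <;> rcases hv with rfl | rfl | rfl
          · exact huv rfl
          · exact hjl1 hadj
          · exact hyj hadj.symm
          · exact hjl1 hadj.symm
          · exact huv rfl
          · exact hyl hadj.symm
          · exact hyj hadj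
          · exact hyl hadj
          · exact huv rfl
        · intro u hu
          simp only [Finset.mem_insert, Finset.mem_singleton] at hu
          rcases hu with rfl | rfl | rfl
          · exact h1
          · exact h2
          · exact fun h => hyi h.symm
        · intro u hu
          simp only [Finset.mem_insert, Finset.mem_singleton] at hu
          rcases hu with rfl | rfl | rfl
          · exact hi1
          · exact hi2
          · exact fun h => hyS i hi h.symm
        · intro hu
          simp only [Finset.mem_insert, Finset.mem_singleton] at hu
          have h9 := hlt9 i hi
          rcases hu with h | h | h
          · exact absurd (hx i hi) (h ▸ F.not_adj_succ (hx j hj))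
          · exact absurd (hx i hi) (h ▸ F.not_adj_succ (hx l hl))
          · exact hy _ h
        · intro hu
          simp only [Finset.mem_insert, Finset.mem_singleton] at hu
          rcases hu with h | h | h
          · exact hij (hinj i hi j hj h)
          · exact hil (hinj i hi l hl h)
          · exact hy _ h
      have hy0 : G.Adj y (c 0) := hadj 0 3 6 (by simp) (by simp) (by simp) (by omega) (by omega)
        (by omega) (hn0 3 (by decide) (by simp)) (hn0 6 (by decide) (by simp))
      have hy3 : G.Adj y (c 3) := hadj 3 0 6 (by simp) (by simp) (by simp) (by omega) (by omega)
        (by omega) (fun h => hneg (1, 3) (by decide) h.symm) (hneg (3, 7) (by decide))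
      -- The cycle y, c_3, x, c_6, c_7, c_2, c_1, c_5, c_4, c_8, c_0 has eleven vertices.
      refine F.not_run_two (fun h => hyx h.symm) hy (F.one 3) (hx 3 (by simp)) (hx 6 (by simp))
        (((((F.up (i := 6) (j := 7) (by omega)).append h27.symm
          (F.down (i := 1) (j := 2) (by omega))).append h51.symm
          (F.down (i := 4) (j := 5) (by omega))).append h84.symm (F.one 8)).append h80 (F.one 0))
        hy0 hy3 (by omega) ?_
      intro i hi
      simp only [Set.mem_union, Set.mem_Icc, Set.mem_singleton_iff]
      omega

end Based

end SimpleGraph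

theorem theorem1p7 {V : Type*} [Fintype V] [DecidableEq V] (G : SimpleGraph V)
    [DecidableRel G.Adj] (k : ℕ) (hk : 2 ≤ k)
    (htough : G.IsTough 1)
    (hconn : G.IsVertexConnected k)
    (hfree : G.IsInducedFree (SimpleGraph.edgeUnionIsolated k))
    (hmu : (((7 * (k : ℝ) - 6) / 5 : ℝ) : EReal) ≤
      ((G.essentialMu (k + 1) : ENNReal) : EReal)) :
    G.IsHamiltonian ∨ Nonempty (G ≃g SimpleGraph.petersenGraph) := by
  refine or_iff_not_imp_left.2 fun hham => ?_
  obtain ⟨n, c, x, F, hbound⟩ := SimpleGraph.exists_config hk hconn hfree hmu hham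
  obtain ⟨c', F', h0, hlast⟩ := F.exists_rotate htough hbound
  exact SimpleGraph.Based.nonempty_iso ⟨F', h0, hlast⟩ hbound
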